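/- **Setting.** Let $M$ be an episodic Markov decision process with horizon $H\ge 1$, state space $\mathcal S$ (an arbitrary set), finite non-empty action set $\mathcal A$, fixed initial state $s_1$, discrete transition probabilities $P_h(\cdot\mid s,a)$ on $\mathcal S$, and deterministic rewards $r_h(s,a)\ge 0$ with $\sum_{h=1}^H r_h\le 1$ along every possible episode. A policy is a sequence $\pi=(\pi_h)_{h=1}^{H}$ of maps $\mathcal S\to\mathcal A$; $V^\pi_h,Q^\pi_h$ are its value functions, $V^\star_h=\sup_\pi V_h^\pi$, $Q^\star_h=\sup_\pi Q_h^\pi$, and $\rho^\pi_h(s,a)=\Pr^\pi[s_h=s,a_h=a]$. Put $(\mathcal T_h f)(s,a)=r_h(s,a)+\mathbb E_{s'\sim P_h(\cdot\mid s,a)}\max_{a'}f(s',a')$. For a policy class $\Pi$, a real $p\ge 1$ and probability distributions $\mu=(\mu_h)_{h=1}^H$ on $\mathcal S\times\mathcal A$, the $L^p$ coverability coefficient is $$C_{\tt cw}=\inf_{\mu_1,\dots,\mu_H}\ \sup_{\pi\in\Pi,\,h\le H}\Big\|\frac{\rho_h^\pi}{\mu_h}\Big\|^p_{L^p(d\mu_h)},\qquad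 \Big\|\frac{\rho}{\mu}\Big\|^p_{L^p(d\mu)}=\sum_{s,a}\mu(s,a)\Big(\frac{\rho(s,a)}{\mu(s,a)}\Big)^p,$$ where the norm is $+\infty$ if $\rho\not\ll\mu$. Assume that $\mu=(\mu_h)$ attains the infimum and that $\sum_{s,a}\sqrt{\mu_h(s,a)}<\infty$ for every $h$. Let $\mathcal F=\mathcal F_1\times\dots\times\mathcal F_H$ with $\mathcal F_h$ a set of functions $\mathcal S\times\mathcal A\to[0,1]$, with the convention $f_{H+1}=0$, $\mathcal F_{H+1}=\{0\}$. Assume *realizability* ($Q^\star_h\in\mathcal F_h$ for all $h\in[H]$) and *Bellman completeness* ($\mathcal T_h f\in\mathcal F_h$ for all $f\in\mathcal F_{h+1}$, $h\in[H]$). For $f\in\mathcal F$ let $\pi^f$ be a greedy policy, $\pi^f_h(s)\in\arg\max_a f_h(s,a)$ (ties broken by a fixed arbitrary rule), and assume $\pi^f\in\Pi$ for all $f\in\mathcal F$. Let $\mathscr N_{\mathcal F}(\epsilon)$ be the minimal number of balls of radius $\epsilon$ in the supremum norm (over $h,s,a$) that cover $\mathcal F$. **GOLF** with parameter $\beta$: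 in episode $t=1,\dots,T$ choose $f^t\in\arg\max_{f\in\mathcal F^{(t-1)}}f_1(s_1,\pi^f_1(s_1))$, run $\pi^t=\pi^{f^t}$ for one episode, and add each $(s_h^t,a_h^t,r_h^t,s_{h+1}^t)$ to the data set $\mathcal D_h^{(t)}$ of step $h$. Here $\mathcal F^{(0)}=\mathcal F$ and $$\mathcal F^{(t)}=\Big\{f\in\mathcal F:\ \mathcal L_h^{(t)}(f_h,f_{h+1})-\inf_{g\in\mathcal F_h}\mathcal L^{(t)}_h(g,f_{h+1})\le\beta\ \ \forall h\in[H]\Big\},$$ $$\mathcal L_h^{(t)}(f,f')=\sum_{(s,a,r,s')\in\mathcal D_h^{(t)}}\big(f(s,a)-r-\max_{a'}f'(s',a')\big)^2 .$$ The regret is $\mathtt{Regret}(T)=\sum_{t=1}^T\big(V^\star_1(s_1)-V^{\pi^t}_1(s_1)\big)$. **Claim.** There are absolute constants $c,K>0$ such that for all $M$, $\Pi$, $p\ge1$ and $\mu$ as above there is a number $L$, depending only on $(M,\Pi,p,\mu)$, with $$L\le K\Big(\max_{h\le H}\sum_{s,a}\mu_h(s,a)^{\min\{1/2,\;1-1/p\}}\Big)^{1/2}$$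 whenever the right-hand side is finite (for $p\ge 2$ it always is, and it equals $K\max_h(\sum_{s,a}\sqrt{\mu_h(s,a)})^{1/2}$), and such that the following holds. For every $\mathcal F$ and every choice of greedy policies as above, every $T\ge2$ with $\mathscr N_{\mathcal F}(1/T)<\infty$ and every $\delta\in(0,1)$, if GOLF is run for $T$ episodes with $\beta=c\log\big(\mathscr N_{\mathcal F}(1/T)\,T\,H/\delta\big)$, then with probability at least $1-\delta$, $$\mathtt{Regret}(T)\ \le\ L\cdot H\sqrt{C_{\tt cw}^{1/p}\,\beta\,T\log T}.$$ -/

import Mathlib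

open scoped ENNReal NNReal

universe u v

noncomputable section

namespace RL

/-- One recorded step `(s_h, a_h, r_h, s_{h+1})` of an episode. -/
structure Step (S : Type u) (A : Type v) where
  state : S
  action : A
  reward : ℝ
  next : S

/-- A non-stationary deterministic policy. Steps are numbered `0, …, H - 1` throughout; only the
components below the horizon matter. -/
abbrev Policy (S : Type u) (A : Type v) := ℕ → S → A

/-- A sequence of action-value functions, indexed by the step. -/
abbrev QFun (S : Type u) (A : Type v) := ℕ → S → A → ℝ

/-- The data of an episodic Markov decision problem with horizon `H`, fixed initial state, transition
probabilities `P h s a` and deterministic rewards `r h s a`. -/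
structure EpisodicMDP (S : Type u) (A : Type v) where
  H : ℕ
  init : S
  P : ℕ → S → A → PMF S
  r : ℕ → S → A → ℝ

namespace EpisodicMDP

variable {S : Type u} {A : Type v} (M : EpisodicMDP S A)

/-- The law of the next `n` steps when action `a` is taken in state `s` at step `h`, and the
policy `π` is followed afterwards. -/
def rollout (π : Policy S A) : ℕ → ℕ → S → A → PMF (List (Step S A))
  | 0, _, _, _ => PMF.pure []
  | n + 1, h, s, a =>
      (M.P h s a).bind fun s' =>
        (rollout π n (h + 1) s' (π (h + 1) s')).map fun l => ⟨s, a, M.r h s a, s'⟩ :: l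

/-- The law of a whole episode under the policy `π`. -/
def episode (π : Policy S A) : PMF (List (Step S A)) :=
  M.rollout π M.H 0 M.init (π 0 M.init)

/-- The total reward collected along a list of steps. -/
def totalReward (l : List (Step S A)) : ℝ := (l.map Step.reward).sum

/-- The action-value function `Q_h^π(s, a)`: expected total reward from step `h` on. -/
def Q (π : Policy S A) (h : ℕ) (s : S) (a : A) : ℝ :=
  ∑' l, (M.rollout π (M.H - h) h s a l).toReal * totalReward l

/-- The state-value function `V_h^π(s)`. -/
def V (π : Policy S A) (h : ℕ) (s : S) : ℝ := M.Q π h s (π h s)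

/-- The optimal action-value function. -/
def Qstar (h : ℕ) (s : S) (a : A) : ℝ := ⨆ π : Policy S A, M.Q π h s a

/-- The optimal state-value function. -/
def Vstar (h : ℕ) (s : S) : ℝ := ⨆ π : Policy S A, M.V π h s

/-- The occupancy measure `ρ_h^π(s, a) = Pr^π[s_h = s, a_h = a]`. -/
def occupancy (π : Policy S A) (h : ℕ) (x : S × A) : ℝ≥0∞ :=
  (M.episode π).toOuterMeasure {l | ∃ e, l[h]? = some e ∧ e.state = x.1 ∧ e.action = x.2}

/-- The Bellman operator `(T_h f)(s, a) = r_h(s, a) + E_{s' ∼ P_h(· | s, a)} max_{a'} f(s', a')`. -/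
def bellman (h : ℕ) (f : S → A → ℝ) (s : S) (a : A) : ℝ :=
  M.r h s a + ∑' s', (M.P h s a s').toReal * ⨆ a', f s' a'

/-- Standing conventions: a positive horizon, non-negative rewards, and total reward at most one
along every possible episode. -/
structure Normalized : Prop where
  horizon_pos : 1 ≤ M.H
  reward_nonneg : ∀ h < M.H, ∀ s a, 0 ≤ M.r h s a
  totalReward_le_one : ∀ π : Policy S A, ∀ l ∈ (M.episode π).support, totalReward l ≤ 1

/-- `‖ρ / μ‖^p` in `L^p(dμ)` for weights `ρ`; it is infinite if `ρ` is not absolutely continuous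
with respect to `μ`, that is, if the density `ρ / μ` does not exist. -/
def ratioNorm {X : Type*} (p : ℝ) (ρ : X → ℝ≥0∞) (μ : PMF X) : ℝ≥0∞ :=
  open Classical in
  if ∀ x, μ x = 0 → ρ x = 0 then ∑' x, μ x * (ρ x / μ x) ^ p else ⊤

/-- `sup_{π ∈ Pol, h} ‖ρ_h^π / μ_h‖^p` in `L^p(dμ_h)`. -/
def coverage (Pol : Set (Policy S A)) (p : ℝ) (μ : ℕ → PMF (S × A)) : ℝ≥0∞ :=
  ⨆ π ∈ Pol, ⨆ h < M.H, ratioNorm p (M.occupancy π h) (μ h)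

/-- The `L^p` coverability coefficient of a policy class. -/
def Ccw (Pol : Set (Policy S A)) (p : ℝ) : ℝ≥0∞ :=
  ⨅ μ : ℕ → PMF (S × A), M.coverage Pol p μ

/-- The product class `F_0 × ⋯ × F_{H-1}`, with `f_h = 0` for `h ≥ H`. -/
def classOf (F : ℕ → Set (S → A → ℝ)) : Set (QFun S A) :=
  {f | (∀ h < M.H, f h ∈ F h) ∧ ∀ h, M.H ≤ h → f h = 0}

/-- Every function in every `F_h` takes values in `[0, 1]`. -/
def UnitRange (F : ℕ → Set (S → A → ℝ)) : Prop :=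
  ∀ h < M.H, ∀ f ∈ F h, ∀ s a, f s a ∈ Set.Icc (0 : ℝ) 1

/-- Realizability: `Q_h^⋆ ∈ F_h` for every step. -/
def Realizable (F : ℕ → Set (S → A → ℝ)) : Prop :=
  ∀ h < M.H, M.Qstar h ∈ F h

/-- Bellman completeness: `T_h F_{h+1} ⊆ F_h` for every step, where the class after the last step
is `{0}`. -/
def BellmanComplete (F : ℕ → Set (S → A → ℝ)) : Prop :=
  (∀ h, h + 1 < M.H → ∀ f ∈ F (h + 1), M.bellman h f ∈ F h) ∧
    ∀ h, h + 1 = M.H → M.bellman h 0 ∈ F h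

/-- The covering number of a class of `H`-tuples of functions in the supremum norm (over the steps,
the states and the actions); the centres of the balls are arbitrary functions. -/
def coveringNumber (𝓕 : Set (QFun S A)) (ε : ℝ) : ℕ∞ :=
  ⨅ (C : Finset (QFun S A)) (_ : ∀ f ∈ 𝓕, ∃ g ∈ C, ∀ h < M.H, ∀ s a, |f h s a - g h s a| ≤ ε),
    (C.card : ℕ∞)

/-- `greedy` assigns to each member `f` of the class a policy with
`π_h^f(s) ∈ argmax_a f_h(s, a)`. -/
def IsGreedyRule (𝓕 : Set (QFun S A)) (greedy : QFun S A → Policy S A) : Prop :=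
  ∀ f ∈ 𝓕, ∀ h < M.H, ∀ s a, f h s a ≤ f h s (greedy f h s)

/-- The data set of step `h` contained in a list of episodes. -/
def dataset (D : List (List (Step S A))) (h : ℕ) : List (Step S A) :=
  D.filterMap fun e => e[h]?

/-- The squared loss `∑ (f(s, a) - r - max_{a'} f'(s', a'))²` over a data set. -/
def loss (D : List (Step S A)) (f f' : S → A → ℝ) : ℝ :=
  (D.map fun e => (f e.state e.action - e.reward - ⨆ a', f' e.next a') ^ 2).sum

/-- The confidence set of GOLF. The condition
`L_h(f_h, f_{h+1}) - inf_{g ∈ F_h} L_h(g, f_{h+1}) ≤ β` is written out for every `g`. -/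
def confidenceSet (F : ℕ → Set (S → A → ℝ)) (β : ℝ) (D : List (List (Step S A))) :
    Set (QFun S A) :=
  {f ∈ M.classOf F | ∀ h < M.H, ∀ g ∈ F h,
    loss (dataset D h) (f h) (f (h + 1)) - loss (dataset D h) g (f (h + 1)) ≤ β}

/-- The law of the first `t` episodes when the function for the next episode is chosen as `sel D`
from the past episodes `D`, and its greedy policy is executed. -/
def runLaw (greedy : QFun S A → Policy S A) (sel : List (List (Step S A)) → QFun S A) :
    ℕ → PMF (List (List (Step S A)))
  | 0 => PMF.pure []
  | t + 1 => (runLaw greedy sel t).bind fun D =>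
      (M.episode (greedy (sel D))).map fun e => D ++ [e]

/-- `sel` is the selection rule of GOLF with confidence parameter `β`, run for `T` episodes: after
every history `D` that can occur, `sel D` maximizes `f ↦ f_1(s_1, π_1^f(s_1))` over the confidence
set. Ties may be broken in any way. -/
def IsGOLF (F : ℕ → Set (S → A → ℝ)) (greedy : QFun S A → Policy S A) (β : ℝ) (T : ℕ)
    (sel : List (List (Step S A)) → QFun S A) : Prop :=
  ∀ t < T, ∀ D ∈ (M.runLaw greedy sel t).support,
    sel D ∈ M.confidenceSet F β D ∧
    ∀ f ∈ M.confidenceSet F β D,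
      f 0 M.init (greedy f 0 M.init) ≤ sel D 0 M.init (greedy (sel D) 0 M.init)

/-- The regret of the `T` episodes recorded in `D`; the policy of an episode is the greedy policy
of the function selected from the episodes before it. -/
def regret (greedy : QFun S A → Policy S A) (sel : List (List (Step S A)) → QFun S A)
    (T : ℕ) (D : List (List (Step S A))) : ℝ :=
  ∑ t ∈ Finset.range T, (M.Vstar 0 M.init - M.V (greedy (sel (D.take t))) 0 M.init)

end EpisodicMDP

end RL

end

/-!
Optimism and the performance-difference identity bound the regret by the Bellman residuals of the
selected functions, averaged over the state-action distributions of their greedy policies and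
summed over all steps and episodes.

For a fixed `f` and step `h`, the exponential of the conditional squared residuals of `f`, scaled by
`1 / 32`, minus the excess squared loss of `f_h` over `T_h f_{h+1}`, scaled by `1 / 8`, is a
supermartingale along the run. A union bound over a net of the class then shows that members of the
confidence set have small squared residuals on the distributions visited so far, and that `Q⋆` stays
in the confidence set.

It remains to pass from squared residuals on past distributions to residuals on the present one. An
elliptic-potential argument does this with a factor of the order of the square root of the
coverability coefficient `C = max_h ∑_x sup_π ρ_h^π(x)`. Finally, a weight at `x` whose `L^p` norm
against `μ` has `p`-th power at most `C_cw` is at most `C_cw^{1/p} μ(x)^{1 - 1/p}`, which gives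
`C ≤ C_cw^{1/p} max_h ∑_x μ_h(x)^{1 - 1/p}`.
-/

namespace RL

section Expectation

variable {α β : Type*}

/-- The expectation of an extended non-negative function under a discrete distribution. -/
noncomputable def lexpect (p : PMF α) (f : α → ℝ≥0∞) : ℝ≥0∞ := ∑' a, p a * f a

theorem lexpect_bind (p : PMF α) (q : α → PMF β) (f : β → ℝ≥0∞) :
    lexpect (p.bind q) f = lexpect p fun a => lexpect (q a) f := by
  simp only [lexpect, PMF.bind_apply, ← ENNReal.tsum_mul_right, ← ENNReal.tsum_mul_left]
  rw [ENNReal.tsum_comm]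
  simp only [mul_assoc]

theorem lexpect_pure (a : α) (f : α → ℝ≥0∞) : lexpect (PMF.pure a) f = f a := by
  rw [lexpect, tsum_eq_single a fun b hb => by simp [hb]]
  simp

theorem lexpect_map (p : PMF α) (g : α → β) (f : β → ℝ≥0∞) :
    lexpect (p.map g) f = lexpect p fun a => f (g a) := by
  simp only [← PMF.bind_pure_comp, lexpect_bind, Function.comp_apply, lexpect_pure]

theorem lexpect_const (p : PMF α) (c : ℝ≥0∞) : lexpect p (fun _ => c) = c := by
  rw [lexpect, ENNReal.tsum_mul_right, p.tsum_coe, one_mul]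

theorem lexpect_const_mul (p : PMF α) (c : ℝ≥0∞) (f : α → ℝ≥0∞) :
    lexpect p (fun a => c * f a) = c * lexpect p f := by
  simp only [lexpect, ← ENNReal.tsum_mul_left, mul_left_comm c]

theorem lexpect_mono {p : PMF α} {f g : α → ℝ≥0∞} (h : ∀ a ∈ p.support, f a ≤ g a) :
    lexpect p f ≤ lexpect p g := by
  refine ENNReal.tsum_le_tsum fun a => ?_
  by_cases ha : p a = 0
  · simp [ha]
  · gcongr
    exact h a ha

theorem mul_toOuterMeasure_le_lexpect (p : PMF α) (f : α → ℝ≥0∞) (c : ℝ≥0∞) :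
    c * p.toOuterMeasure {a | c ≤ f a} ≤ lexpect p f := by
  rw [PMF.toOuterMeasure_apply, ← ENNReal.tsum_mul_left]
  refine ENNReal.tsum_le_tsum fun a => ?_
  by_cases ha : c ≤ f a
  · rw [Set.indicator_of_mem (by exact ha), mul_comm]
    gcongr
  · simp [Set.indicator_of_notMem (s := {a | c ≤ f a}) ha]

theorem toOuterMeasure_lt_le_exp_neg (p : PMF α) (Z : α → ℝ) (ℓ : ℝ)
    (hZ : lexpect p (fun a => ENNReal.ofReal (Real.exp (Z a))) ≤ 1) :
    p.toOuterMeasure {a | ℓ < Z a} ≤ ENNReal.ofReal (Real.exp (-ℓ)) := by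
  have hpos : ENNReal.ofReal (Real.exp ℓ) ≠ 0 := by
    simpa only [ne_eq, ENNReal.ofReal_eq_zero, not_le] using Real.exp_pos ℓ
  have hmarkov := (mul_toOuterMeasure_le_lexpect p _ (ENNReal.ofReal (Real.exp ℓ))).trans hZ
  rw [Real.exp_neg, ENNReal.ofReal_inv_of_pos (Real.exp_pos ℓ),
    ← one_div, ENNReal.le_div_iff_mul_le (.inl hpos) (.inl ENNReal.ofReal_ne_top), mul_comm]
  refine le_trans ?_ hmarkov
  gcongr with a
  exact fun ha => ENNReal.ofReal_le_ofReal (Real.exp_le_exp.2 ha.le)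

theorem ofReal_one_sub_le_toOuterMeasure {p : PMF α} {G B : Set α} {δ : ℝ} (hδ : 0 ≤ δ)
    (hB : p.toOuterMeasure B ≤ ENNReal.ofReal δ) (hGB : p.support ⊆ G ∪ B) :
    ENNReal.ofReal (1 - δ) ≤ p.toOuterMeasure G := by
  rw [ENNReal.ofReal_sub _ hδ, ENNReal.ofReal_one, tsub_le_iff_right]
  calc (1 : ℝ≥0∞) = p.toOuterMeasure p.support :=
        ((p.toOuterMeasure_apply_eq_one_iff _).2 subset_rfl).symm
    _ ≤ p.toOuterMeasure (G ∪ B) := MeasureTheory.measure_mono hGB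
    _ ≤ p.toOuterMeasure G + p.toOuterMeasure B := MeasureTheory.measure_union_le _ _
    _ ≤ p.toOuterMeasure G + ENNReal.ofReal δ := by gcongr

theorem summable_toReal (p : PMF α) : Summable fun a => (p a).toReal :=
  ENNReal.summable_toReal p.tsum_coe_ne_top

/-- The expectation of a real function under a discrete distribution; it is `0` unless
`HasExpect p f` holds. -/
noncomputable def expect (p : PMF α) (f : α → ℝ) : ℝ := ∑' a, (p a).toReal * f a

/-- Integrability of a real function with respect to a discrete distribution. -/
def HasExpect (p : PMF α) (f : α → ℝ) : Prop := Summable fun a => (p a).toReal * f a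

theorem HasExpect.of_abs_le {p : PMF α} {f : α → ℝ} {C : ℝ} (h : ∀ a ∈ p.support, |f a| ≤ C) :
    HasExpect p f := by
  refine .of_norm_bounded ((summable_toReal p).mul_right C) fun a => ?_
  rw [norm_mul, Real.norm_of_nonneg ENNReal.toReal_nonneg, Real.norm_eq_abs]
  by_cases ha : p a = 0
  · simp [ha]
  · exact mul_le_mul_of_nonneg_left (h a ha) ENNReal.toReal_nonneg

theorem hasExpect_const (p : PMF α) (c : ℝ) : HasExpect p fun _ => c :=
  (summable_toReal p).mul_right c

theorem HasExpect.add {p : PMF α} {f g : α → ℝ} (hf : HasExpect p f) (hg : HasExpect p g) :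
    HasExpect p fun a => f a + g a := by
  simpa only [HasExpect, mul_add] using Summable.add hf hg

theorem expect_congr {p : PMF α} {f g : α → ℝ} (h : ∀ a ∈ p.support, f a = g a) :
    expect p f = expect p g := by
  refine tsum_congr fun a => ?_
  by_cases ha : p a = 0
  · simp [ha]
  · rw [h a ha]

theorem expect_const (p : PMF α) (c : ℝ) : expect p (fun _ => c) = c := by
  rw [expect, tsum_mul_right, ← ENNReal.tsum_toReal_eq p.apply_ne_top, p.tsum_coe,
    ENNReal.toReal_one, one_mul]

theorem expect_const_mul (p : PMF α) (c : ℝ) (f : α → ℝ) :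
    expect p (fun a => c * f a) = c * expect p f := by
  simp only [expect, ← tsum_mul_left, mul_left_comm c]

theorem expect_add {p : PMF α} {f g : α → ℝ} (hf : HasExpect p f) (hg : HasExpect p g) :
    expect p (fun a => f a + g a) = expect p f + expect p g := by
  simpa only [expect, mul_add] using Summable.tsum_add hf hg

theorem expect_sub {p : PMF α} {f g : α → ℝ} (hf : HasExpect p f) (hg : HasExpect p g) :
    expect p (fun a => f a - g a) = expect p f - expect p g := by
  simpa only [expect, mul_sub] using Summable.tsum_sub hf hg

theorem expect_sum {ι : Type*} {p : PMF α} {s : Finset ι} {f : ι → α → ℝ}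
    (hf : ∀ i ∈ s, HasExpect p (f i)) :
    expect p (fun a => ∑ i ∈ s, f i a) = ∑ i ∈ s, expect p (f i) := by
  simp only [expect, Finset.mul_sum]
  exact Summable.tsum_finsetSum hf

theorem expect_mono {p : PMF α} {f g : α → ℝ} (hf : HasExpect p f) (hg : HasExpect p g)
    (h : ∀ a ∈ p.support, f a ≤ g a) : expect p f ≤ expect p g := by
  refine Summable.tsum_le_tsum (fun a => ?_) hf hg
  by_cases ha : p a = 0
  · simp [ha]
  · exact mul_le_mul_of_nonneg_left (h a ha) ENNReal.toReal_nonneg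

theorem abs_expect_le {p : PMF α} {f : α → ℝ} {C : ℝ} (h : ∀ a ∈ p.support, |f a| ≤ C) :
    |expect p f| ≤ C := by
  have hf : HasExpect p f := .of_abs_le h
  refine abs_le.2 ⟨?_, ?_⟩
  · rw [← expect_const p (-C)]
    exact expect_mono (hasExpect_const p _) hf fun a ha => (abs_le.1 (h a ha)).1
  · rw [← expect_const p C]
    exact expect_mono hf (hasExpect_const p _) fun a ha => (abs_le.1 (h a ha)).2

theorem expect_mem_Icc {p : PMF α} {f : α → ℝ} (h : ∀ a, f a ∈ Set.Icc (0 : ℝ) 1) :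
    expect p f ∈ Set.Icc (0 : ℝ) 1 :=
  ⟨tsum_nonneg fun a => mul_nonneg ENNReal.toReal_nonneg (h a).1,
    (le_abs_self _).trans
      (abs_expect_le fun a _ => abs_le.2 ⟨by linarith [(h a).1], (h a).2⟩)⟩

theorem ofReal_expect {p : PMF α} {f : α → ℝ} (hf : HasExpect p f) (h0 : ∀ a, 0 ≤ f a) :
    ENNReal.ofReal (expect p f) = lexpect p fun a => ENNReal.ofReal (f a) := by
  rw [expect, lexpect, ENNReal.ofReal_tsum_of_nonneg
    (fun a => mul_nonneg ENNReal.toReal_nonneg (h0 a)) hf]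
  refine tsum_congr fun a => ?_
  rw [ENNReal.ofReal_mul ENNReal.toReal_nonneg, ENNReal.ofReal_toReal (p.apply_ne_top a)]

theorem expect_pure (a : α) (f : α → ℝ) : expect (PMF.pure a) f = f a := by
  rw [expect, tsum_eq_single a fun b hb => by simp [hb]]
  simp

theorem expect_bind {p : PMF α} {q : α → PMF β} {f : β → ℝ} (hf : HasExpect (p.bind q) f) :
    expect (p.bind q) f = expect p fun a => expect (q a) f := by
  have hsum : ∀ b, Summable fun a => (p a).toReal * (q a b).toReal := fun b => by
    simpa only [ENNReal.toReal_mul, PMF.bind_apply] using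
      ENNReal.summable_toReal ((p.bind q).apply_ne_top b)
  have hbind : ∀ b, (p.bind q b).toReal = ∑' a, (p a).toReal * (q a b).toReal := fun b => by
    rw [PMF.bind_apply, ENNReal.tsum_toReal_eq fun a =>
      ENNReal.mul_ne_top (p.apply_ne_top a) ((q a).apply_ne_top b)]
    simp only [ENNReal.toReal_mul]
  have hjoint : Summable (Function.uncurry fun b a => (p a).toReal * (q a b).toReal * f b) := by
    refine Summable.of_norm ((summable_prod_of_nonneg fun _ => norm_nonneg _).2 ⟨fun b => ?_, ?_⟩)
    · exact ((hsum b).mul_right (f b)).norm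
    · refine hf.norm.congr fun b => ?_
      simp only [Function.uncurry_apply_pair, norm_mul, Real.norm_of_nonneg ENNReal.toReal_nonneg,
        tsum_mul_right, ← hbind]
  calc expect (p.bind q) f = ∑' b, ∑' a, (p a).toReal * (q a b).toReal * f b := by
        simp only [expect, hbind, tsum_mul_right]
    _ = ∑' a, ∑' b, (p a).toReal * (q a b).toReal * f b := hjoint.tsum_comm.symm
    _ = expect p fun a => expect (q a) f := by
        simp only [expect, mul_assoc, tsum_mul_left]

theorem expect_map {p : PMF α} {g : α → β} {f : β → ℝ} (hf : HasExpect (p.map g) f) :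
    expect (p.map g) f = expect p fun a => f (g a) := by
  rw [← PMF.bind_pure_comp] at hf ⊢
  simp only [expect_bind hf, Function.comp_apply, expect_pure]

theorem lexpect_exp_le_one_add {p : PMF α} {f g : α → ℝ} {C : ℝ}
    (hg : ∀ a, |g a| ≤ C) (hfg : ∀ a, Real.exp (f a) ≤ 1 + g a) :
    lexpect p (fun a => ENNReal.ofReal (Real.exp (f a))) ≤ ENNReal.ofReal (1 + expect p g) := by
  have hgE : HasExpect p g := .of_abs_le fun a _ => hg a
  calc lexpect p (fun a => ENNReal.ofReal (Real.exp (f a)))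
      ≤ lexpect p (fun a => ENNReal.ofReal (1 + g a)) :=
        lexpect_mono fun a _ => ENNReal.ofReal_le_ofReal (hfg a)
    _ = ENNReal.ofReal (1 + expect p g) := by
        rw [← ofReal_expect ((hasExpect_const p 1).add hgE)
          fun a => (Real.exp_pos _).le.trans (hfg a), expect_add (hasExpect_const p 1) hgE,
          expect_const]

theorem lexpect_exp_centered_le {p : PMF α} {v : α → ℝ} (hv : ∀ a, |v a - expect p v| ≤ 1)
    {l : ℝ} (hl : |l| ≤ 1) :
    lexpect p (fun a => ENNReal.ofReal (Real.exp (l * (v a - expect p v)))) ≤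
      ENNReal.ofReal (Real.exp (l ^ 2)) := by
  have hvE : HasExpect p v := .of_abs_le (C := 1 + |expect p v|) fun a _ => by
    linarith [abs_sub_abs_le_abs_sub (v a) (expect p v), hv a]
  have hmean : expect p (fun a => l * (v a - expect p v)) = 0 := by
    rw [expect_const_mul, expect_sub hvE (hasExpect_const p _), expect_const, sub_self, mul_zero]
  have habs : ∀ a, |l * (v a - expect p v)| ≤ |l| := fun a => by
    rw [abs_mul]
    exact mul_le_of_le_one_right (abs_nonneg l) (hv a)
  have hquad : ∀ a, Real.exp (l * (v a - expect p v)) ≤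
      1 + (l * (v a - expect p v) + l ^ 2) := fun a => by
    have htaylor := Real.abs_exp_sub_one_sub_id_le ((habs a).trans hl)
    have hsq := sq_le_sq.2 ((habs a).trans_eq (abs_abs l).symm)
    linarith [(abs_le.1 htaylor).2, sq_abs l]
  refine (lexpect_exp_le_one_add (C := |l| + l ^ 2) (fun a => ?_) hquad).trans ?_
  · exact (abs_add_le _ _).trans (add_le_add (habs a) (abs_of_nonneg (sq_nonneg l)).le)
  · rw [expect_add (.of_abs_le fun a _ => habs a) (hasExpect_const p _), hmean, expect_const,
      zero_add, add_comm]
    exact ENNReal.ofReal_le_ofReal (Real.add_one_le_exp _)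

theorem lexpect_exp_neg_le {p : PMF α} {φ : α → ℝ} (hφ : ∀ a, φ a ∈ Set.Icc (0 : ℝ) 1) :
    lexpect p (fun a => ENNReal.ofReal (Real.exp (-φ a))) ≤
      ENNReal.ofReal (Real.exp (-(expect p φ / 2))) := by
  have hlin : ∀ a, Real.exp (-φ a) ≤ 1 + (-(1 / 2)) * φ a := fun a => by
    obtain ⟨h0, h1⟩ := hφ a
    rw [Real.exp_neg, inv_le_iff_one_le_mul₀ (Real.exp_pos _)]
    nlinarith [Real.add_one_le_exp (φ a)]
  refine (lexpect_exp_le_one_add (C := 1) (fun a => ?_) hlin).trans ?_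
  · rw [abs_le]
    constructor <;> linarith [(hφ a).1, (hφ a).2]
  · rw [expect_const_mul]
    refine ENNReal.ofReal_le_ofReal ?_
    linarith [Real.add_one_le_exp (-(expect p φ / 2))]

end Expectation

end RL
namespace RL

section Potential

open Finset

theorem half_le_log_one_add {u : ℝ} (h0 : 0 ≤ u) (h1 : u ≤ 1) : u / 2 ≤ Real.log (1 + u) := by
  refine le_trans ?_ (Real.one_sub_inv_le_log_of_pos (by linarith))
  rw [le_sub_iff_add_le, ← le_sub_iff_add_le', inv_le_iff_one_le_mul₀ (by linarith)]
  nlinarith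

theorem sum_ite_lt_prefix_le {a : ℕ → ℝ} {m : ℝ} {T : ℕ} (h0 : ∀ t, 0 ≤ a t)
    (ham : ∀ t < T, a t ≤ m) (hm : 0 ≤ m) :
    ∑ t ∈ range T, (if ∑ i ∈ range t, a i < m then a t else 0) ≤ 2 * m := by
  set S : ℕ → ℝ := fun t => ∑ i ∈ range t, a i
  have hstep : ∀ t ∈ range T, (if S t < m then a t else 0) ≤
      min (S (t + 1)) (2 * m) - min (S t) (2 * m) := fun t ht => by
    have hsucc : S (t + 1) = S t + a t := sum_range_succ a t
    have hat := ham t (mem_range.1 ht)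
    split_ifs with hSt
    · rw [min_eq_left (by linarith), min_eq_left (by linarith)]
      linarith
    · exact sub_nonneg.2 (min_le_min_right _ (by linarith [h0 t]))
  calc _ ≤ ∑ t ∈ range T, (min (S (t + 1)) (2 * m) - min (S t) (2 * m)) := sum_le_sum hstep
    _ = min (S T) (2 * m) - min (S 0) (2 * m) := sum_range_sub (fun t => min (S t) (2 * m)) T
    _ ≤ 2 * m := by
        have hzero : min (S 0) (2 * m) = 0 := min_eq_left (by simpa [S] using hm)
        linarith [min_le_right (S T) (2 * m)]

theorem sq_div_le_mul_log_sub {a m s : ℝ} (h0 : 0 ≤ a) (ham : a ≤ m) (hms : m ≤ s)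
    (hm : 0 < m) : a ^ 2 / s ≤ 2 * m * (Real.log (s + a) - Real.log s) := by
  have hs : 0 < s := hm.trans_le hms
  have hlog := half_le_log_one_add (div_nonneg h0 hs.le) (div_le_one_of_le₀ (ham.trans hms) hs.le)
  calc a ^ 2 / s = a * (a / s) := by ring
    _ ≤ m * (2 * Real.log (1 + a / s)) :=
        mul_le_mul ham (by linarith) (div_nonneg h0 hs.le) hm.le
    _ = 2 * m * (Real.log (s + a) - Real.log s) := by
        rw [← Real.log_div (by positivity) hs.ne', add_div, div_self hs.ne']
        ring

theorem sum_sq_div_prefix_le {a : ℕ → ℝ} {m : ℝ} {T : ℕ} (h0 : ∀ t, 0 ≤ a t)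
    (ham : ∀ t < T, a t ≤ m) (hm : 0 < m) :
    ∑ t ∈ range T, (if ∑ i ∈ range t, a i < m then 0 else a t ^ 2 / ∑ i ∈ range t, a i) ≤
      2 * m * Real.log T := by
  set S : ℕ → ℝ := fun t => ∑ i ∈ range t, a i
  have hpos : ∀ t, 0 < max (S t) m := fun t => lt_max_of_lt_right hm
  have hmono : ∀ t, S t ≤ S (t + 1) := fun t => by
    simpa only [S, sum_range_succ] using le_add_of_nonneg_right (h0 t)
  have hstep : ∀ t ∈ range T, (if S t < m then 0 else a t ^ 2 / S t) ≤
      2 * m * (Real.log (max (S (t + 1)) m) - Real.log (max (S t) m)) := fun t ht => by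
    have hat := ham t (mem_range.1 ht)
    split_ifs with hSt
    · refine mul_nonneg (by positivity) (sub_nonneg.2 (Real.log_le_log (hpos t) ?_))
      exact max_le_max_right m (hmono t)
    · have hmS : m ≤ S t := not_lt.1 hSt
      rw [max_eq_left hmS, max_eq_left (hmS.trans (hmono t)), show S (t + 1) = S t + a t from
        sum_range_succ a t]
      exact sq_div_le_mul_log_sub (h0 t) hat hmS hm
  have hfinal : Real.log (max (S T) m) ≤ Real.log m + Real.log T := by
    rcases T.eq_zero_or_pos with rfl | hT
    · simp [S, hm.le]
    · have hT1 : (1 : ℝ) ≤ T := by exact_mod_cast hT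
      rw [← Real.log_mul hm.ne' (by positivity)]
      refine Real.log_le_log (hpos T) (max_le ?_ (le_mul_of_one_le_right hm.le hT1))
      simpa [mul_comm] using sum_le_card_nsmul (range T) a m fun t ht => ham t (mem_range.1 ht)
  calc _ ≤ ∑ t ∈ range T,
        2 * m * (Real.log (max (S (t + 1)) m) - Real.log (max (S t) m)) := sum_le_sum hstep
    _ = 2 * m * (Real.log (max (S T) m) - Real.log m) := by
        rw [← mul_sum, sum_range_sub fun t => Real.log (max (S t) m)]
        simp [S, hm.le]
    _ ≤ 2 * m * Real.log T := by
        gcongr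
        linarith

theorem sum_mul_le_potential {a y : ℕ → ℝ} {m : ℝ} {T : ℕ} (h0 : ∀ t, 0 ≤ a t)
    (ham : ∀ t < T, a t ≤ m) (hm : 0 ≤ m) (hy : ∀ t < T, y t ≤ 1) {η : ℝ} (hη : 0 < η) :
    ∑ t ∈ range T, a t * y t ≤ 2 * m + η * m * Real.log T +
      (2 * η)⁻¹ * ∑ t ∈ range T, ∑ i ∈ range t, a i * y t ^ 2 := by
  simp only [← sum_mul]
  rcases hm.eq_or_lt with rfl | hm
  · have hzero : ∀ t ∈ range T, a t = 0 := fun t ht =>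
      le_antisymm (ham t (mem_range.1 ht)) (h0 t)
    rw [sum_eq_zero fun t ht => by rw [hzero t ht, zero_mul]]
    simpa using mul_nonneg (by positivity) (sum_nonneg fun t _ =>
      mul_nonneg (sum_nonneg fun i _ => h0 i) (sq_nonneg (y t)))
  set S : ℕ → ℝ := fun t => ∑ i ∈ range t, a i
  -- AM-GM: `2 a y ≤ η a² / S + S y² / η`
  have hpoint : ∀ t ∈ range T, a t * y t ≤ (if S t < m then a t else 0) +
      η / 2 * (if S t < m then 0 else a t ^ 2 / S t) + (2 * η)⁻¹ * (S t * y t ^ 2) :=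
    fun t ht => by
    have hS0 : 0 ≤ S t := sum_nonneg fun i _ => h0 i
    have hlast : 0 ≤ (2 * η)⁻¹ * (S t * y t ^ 2) := by positivity
    split_ifs with hSt
    · nlinarith [mul_le_of_le_one_right (h0 t) (hy t (mem_range.1 ht))]
    · have hS : 0 < S t := hm.trans_le (not_lt.1 hSt)
      have hsq : 0 ≤ (η * a t - S t * y t) ^ 2 / (2 * η * S t) := by positivity
      have hexpand : (η * a t - S t * y t) ^ 2 / (2 * η * S t) =
          η / 2 * (a t ^ 2 / S t) + (2 * η)⁻¹ * (S t * y t ^ 2) - a t * y t := by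
        field_simp
        ring
      linarith
  have hsum := sum_le_sum hpoint
  rw [sum_add_distrib, sum_add_distrib, ← mul_sum, ← mul_sum] at hsum
  have hsmall := sum_ite_lt_prefix_le h0 ham hm.le
  have hlarge := mul_le_mul_of_nonneg_left (sum_sq_div_prefix_le h0 ham hm) (half_pos hη).le
  linarith

theorem sum_expect_le_potential {X : Type*} {d : ℕ → PMF X} {m : X → ℝ} {T : ℕ}
    (hd : ∀ t < T, ∀ x, (d t x).toReal ≤ m x) (hm0 : ∀ x, 0 ≤ m x) (hm : Summable m)
    {φ : ℕ → X → ℝ} (hφ : ∀ t < T, ∀ x, |φ t x| ≤ 1) {η : ℝ} (hη : 0 < η) :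
    ∑ t ∈ range T, expect (d t) (φ t) ≤ 2 * ∑' x, m x + η * (∑' x, m x) * Real.log T +
      (2 * η)⁻¹ * ∑ t ∈ range T, ∑ i ∈ range t, expect (d i) fun x => φ t x ^ 2 := by
  have hφE : ∀ t ∈ range T, HasExpect (d t) (φ t) := fun t ht =>
    .of_abs_le fun x _ => hφ t (mem_range.1 ht) x
  have hsqE : ∀ t ∈ range T, ∀ i ∈ range t, HasExpect (d i) fun x => φ t x ^ 2 :=
    fun t ht i _ => .of_abs_le (C := 1) fun x _ => by
      rw [abs_pow]
      exact pow_le_one₀ (abs_nonneg _) (hφ t (mem_range.1 ht) x)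
  have hinner : ∀ t ∈ range T,
      Summable fun x => ∑ i ∈ range t, (d i x).toReal * φ t x ^ 2 := fun t ht =>
    summable_sum (hsqE t ht)
  have hlin : Summable fun x => 2 * m x + η * m x * Real.log T :=
    (hm.mul_left 2).add ((hm.mul_left η).mul_right _)
  have hquad : Summable fun x =>
      (2 * η)⁻¹ * ∑ t ∈ range T, ∑ i ∈ range t, (d i x).toReal * φ t x ^ 2 :=
    (summable_sum hinner).mul_left _
  calc ∑ t ∈ range T, expect (d t) (φ t)
      = ∑' x, ∑ t ∈ range T, (d t x).toReal * φ t x :=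
        (Summable.tsum_finsetSum hφE).symm
    _ ≤ ∑' x, (2 * m x + η * m x * Real.log T +
          (2 * η)⁻¹ * ∑ t ∈ range T, ∑ i ∈ range t, (d i x).toReal * φ t x ^ 2) :=
        Summable.tsum_le_tsum (fun x => sum_mul_le_potential (fun _ => ENNReal.toReal_nonneg)
          (fun t ht => hd t ht x) (hm0 x) (fun t ht => (le_abs_self _).trans (hφ t ht x)) hη)
          (summable_sum hφE) (hlin.add hquad)
    _ = _ := by
        rw [hlin.tsum_add hquad, (hm.mul_left 2).tsum_add ((hm.mul_left η).mul_right _),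
          tsum_mul_left, tsum_mul_right, tsum_mul_left, tsum_mul_left,
          Summable.tsum_finsetSum hinner,
          sum_congr rfl fun t ht => Summable.tsum_finsetSum (hsqE t ht)]
        simp only [expect]

theorem exists_mul_add_div_eq_two_mul_sqrt {P Q : ℝ} (hP : 0 < P) (hQ : 0 < Q) :
    ∃ η > 0, η * P + Q / η = 2 * √(P * Q) := by
  refine ⟨√Q / √P, by positivity, ?_⟩
  rw [Real.sqrt_mul hP.le]
  field_simp
  rw [Real.sq_sqrt hP.le, Real.sq_sqrt hQ.le]
  ring

theorem sum_expect_le_of_sum_expect_sq_le {X : Type*} {d : ℕ → PMF X} {m : X → ℝ} {T : ℕ}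
    (hd : ∀ t < T, ∀ x, (d t x).toReal ≤ m x) (hm0 : ∀ x, 0 ≤ m x) (hm : Summable m)
    (hpos : 0 < ∑' x, m x) {φ : ℕ → X → ℝ} (hφ : ∀ t < T, ∀ x, |φ t x| ≤ 1) (hT : 2 ≤ T) {R : ℝ}
    (hR : 0 < R)
    (hsq : ∀ t < T, ∑ i ∈ range t, expect (d i) (fun x => φ t x ^ 2) ≤ R) :
    ∑ t ∈ range T, expect (d t) (φ t) ≤
      2 * ∑' x, m x + √(2 * (∑' x, m x) * R * T * Real.log T) := by
  have hT0 : (0 : ℝ) < T := by positivity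
  have hlog : 0 < Real.log T := Real.log_pos (by exact_mod_cast hT)
  set C := ∑' x, m x
  obtain ⟨η, hη, heq⟩ :=
    exists_mul_add_div_eq_two_mul_sqrt (mul_pos hpos hlog) (half_pos (mul_pos hT0 hR))
  have hsqrt : 2 * √(C * Real.log T * (T * R / 2)) = √(2 * C * R * T * Real.log T) := by
    rw [← Real.sqrt_sq zero_le_two, ← Real.sqrt_mul (by positivity)]
    ring_nf
  have hsum : ∑ t ∈ range T, ∑ i ∈ range t, expect (d i) (fun x => φ t x ^ 2) ≤ T * R := by
    simpa using sum_le_card_nsmul (range T) _ R fun t ht => hsq t (mem_range.1 ht)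
  calc ∑ t ∈ range T, expect (d t) (φ t)
      ≤ 2 * C + η * C * Real.log T + (2 * η)⁻¹ * (T * R) :=
        (sum_expect_le_potential hd hm0 hm hφ hη).trans (by gcongr)
    _ = 2 * C + (η * (C * Real.log T) + T * R / 2 / η) := by
        field_simp
        ring
    _ = 2 * C + √(2 * C * R * T * Real.log T) := by rw [heq, hsqrt]

end Potential

end RL
namespace RL

section Supremum

variable {A : Type v}

theorem ciSup_eq_of_forall_le [Finite A] [Nonempty A] {g : A → ℝ} {a : A} (h : ∀ b, g b ≤ g a) :
    ⨆ b, g b = g a :=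
  le_antisymm (ciSup_le h) (le_ciSup (Set.finite_range g).bddAbove a)

theorem ciSup_mem_of_finite [Finite A] [Nonempty A] {g : A → ℝ} {s : Set ℝ} (hg : ∀ a, g a ∈ s) :
    ⨆ a, g a ∈ s := by
  obtain ⟨a, ha⟩ := Finite.exists_max g
  rw [ciSup_eq_of_forall_le ha]
  exact hg a

theorem abs_ciSup_sub_ciSup_le [Finite A] [Nonempty A] {f g : A → ℝ} {ε : ℝ}
    (h : ∀ a, |f a - g a| ≤ ε) : |(⨆ a, f a) - ⨆ a, g a| ≤ ε := by
  have hle : ∀ {u v : A → ℝ}, (∀ a, u a ≤ ε + v a) → (⨆ a, u a) - ⨆ a, v a ≤ ε :=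
    fun {u v} huv => sub_le_iff_le_add.2 <| ciSup_le fun a =>
      (huv a).trans (by gcongr; exact le_ciSup (Set.finite_range v).bddAbove a)
  refine abs_sub_le_iff.2 ⟨hle fun a => ?_, hle fun a => ?_⟩ <;>
    linarith [abs_le.1 (h a)]

end Supremum

namespace EpisodicMDP

variable {S : Type u} {A : Type v} (M : EpisodicMDP S A)

section Laws

/-- The law of the state-action pair reached after `k` transitions when action `a` is taken in
state `s` at step `h`, and the policy `π` is followed afterwards. -/
noncomputable def stepLaw (π : Policy S A) : ℕ → ℕ → S → A → PMF (S × A)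
  | 0, _, s, a => PMF.pure (s, a)
  | k + 1, h, s, a => (M.P h s a).bind fun s' => stepLaw π k (h + 1) s' (π (h + 1) s')

/-- The law of the state-action pair visited at step `h` of an episode. Unlike `occupancy`, it is
defined without reference to the recorded trajectory, and it makes sense beyond the horizon. -/
noncomputable def visitLaw (π : Policy S A) (h : ℕ) : PMF (S × A) :=
  M.stepLaw π h 0 M.init (π 0 M.init)

theorem rollout_map_getElem? (π : Policy S A) {n k : ℕ} (hk : k < n) (h : ℕ) (s : S) (a : A) :
    (M.rollout π n h s a).map (fun l => l[k]?) =
      (M.stepLaw π k h s a).bind fun x => (M.P (h + k) x.1 x.2).map fun s' =>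
        some ⟨x.1, x.2, M.r (h + k) x.1 x.2, s'⟩ := by
  induction k generalizing n h s a with
  | zero =>
    obtain ⟨n, rfl⟩ := Nat.exists_eq_add_of_lt hk
    simp only [zero_add, rollout, stepLaw, PMF.map_bind, PMF.map_comp, PMF.pure_bind,
      Function.comp_def, List.getElem?_cons_zero, add_zero]
    rw [← PMF.bind_pure_comp]
    exact congrArg _ (funext fun s' => PMF.map_const _ _)
  | succ k ih =>
    obtain ⟨n, rfl⟩ := Nat.exists_eq_add_of_lt (Nat.zero_lt_of_lt hk)
    simp only [zero_add, rollout, stepLaw, PMF.map_bind, PMF.map_comp, PMF.bind_bind,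
      Function.comp_def, List.getElem?_cons_succ]
    refine congrArg _ (funext fun s' => ?_)
    rw [ih (by omega), show h + 1 + k = h + (k + 1) by ring]

theorem episode_map_getElem? (π : Policy S A) {h : ℕ} (hh : h < M.H) :
    (M.episode π).map (fun l => l[h]?) =
      (M.visitLaw π h).bind fun x => (M.P h x.1 x.2).map fun s' =>
        some ⟨x.1, x.2, M.r h x.1 x.2, s'⟩ := by
  simpa only [zero_add, episode, visitLaw] using
    M.rollout_map_getElem? π hh 0 M.init (π 0 M.init)

theorem occupancy_eq_visitLaw (π : Policy S A) {h : ℕ} (hh : h < M.H) (x : S × A) :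
    M.occupancy π h x = M.visitLaw π h x := by
  have hset : {l : List (Step S A) | ∃ e, l[h]? = some e ∧ e.state = x.1 ∧ e.action = x.2} =
      (fun l : List (Step S A) => l[h]?) ⁻¹'
        ((Option.map fun e : Step S A => (e.state, e.action)) ⁻¹' {some x}) := by
    ext l
    simp [Prod.ext_iff]
  have hsome : ((M.visitLaw π h).bind fun x => (M.P h x.1 x.2).map fun _ => some x) =
      (M.visitLaw π h).map some := by
    rw [← PMF.bind_pure_comp]
    exact congrArg _ (funext fun x => PMF.map_const _ _)
  rw [occupancy, hset, ← PMF.toOuterMeasure_map_apply, M.episode_map_getElem? π hh,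
    ← PMF.toOuterMeasure_map_apply, PMF.map_bind]
  simp only [PMF.map_comp, Function.comp_def, Option.map_some]
  rw [hsome, PMF.toOuterMeasure_map_apply, show some ⁻¹' {some x} = {x} by ext; simp,
    PMF.toOuterMeasure_apply_singleton]

variable {M}

theorem mem_support_rollout_succ {π : Policy S A} {n h : ℕ} {s : S} {a : A}
    {l : List (Step S A)} (hl : l ∈ (M.rollout π (n + 1) h s a).support) :
    ∃ s' l', l' ∈ (M.rollout π n (h + 1) s' (π (h + 1) s')).support ∧
      l = ⟨s, a, M.r h s a, s'⟩ :: l' := by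
  simp only [rollout, PMF.mem_support_bind_iff, PMF.mem_support_map_iff] at hl
  obtain ⟨s', -, l', hl', rfl⟩ := hl
  exact ⟨s', l', hl', rfl⟩

theorem reward_eq_of_mem_support_rollout {π : Policy S A} {n h : ℕ} {s : S} {a : A}
    {l : List (Step S A)} (hl : l ∈ (M.rollout π n h s a).support) {k : ℕ} {e : Step S A}
    (he : l[k]? = some e) : e.reward = M.r (h + k) e.state e.action := by
  induction n generalizing h s a l k with
  | zero =>
    simp only [rollout, PMF.support_pure, Set.mem_singleton_iff] at hl
    simp [hl] at he
  | succ n ih =>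
    obtain ⟨s', l', hl', rfl⟩ := mem_support_rollout_succ hl
    cases k with
    | zero =>
      simp only [List.getElem?_cons_zero, Option.some.injEq] at he
      simp [← he]
    | succ k =>
      rw [List.getElem?_cons_succ] at he
      rw [ih hl' he, show h + 1 + k = h + (k + 1) by ring]

theorem reward_eq_of_mem_support_episode {π : Policy S A} {l : List (Step S A)}
    (hl : l ∈ (M.episode π).support) {h : ℕ} {e : Step S A} (he : l[h]? = some e) :
    e.reward = M.r h e.state e.action := by
  simpa only [zero_add] using reward_eq_of_mem_support_rollout hl he

end Laws

section Values

theorem Q_eq_expect (π : Policy S A) (h : ℕ) (s : S) (a : A) :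
    M.Q π h s a = expect (M.rollout π (M.H - h) h s a) totalReward := rfl

theorem bellman_eq_expect (h : ℕ) (f : S → A → ℝ) (s : S) (a : A) :
    M.bellman h f s a = M.r h s a + expect (M.P h s a) fun s' => ⨆ a', f s' a' := rfl

theorem Q_of_horizon_le (π : Policy S A) {h : ℕ} (hh : M.H ≤ h) (s : S) (a : A) :
    M.Q π h s a = 0 := by
  rw [Q_eq_expect, Nat.sub_eq_zero_of_le hh, rollout, expect_pure]
  rfl

theorem Qstar_of_horizon_le {h : ℕ} (hh : M.H ≤ h) : M.Qstar h = 0 := by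
  funext s a
  simp [Qstar, M.Q_of_horizon_le _ hh]

variable {M} {b : ℝ}

theorem totalReward_cons (e : Step S A) (l : List (Step S A)) :
    totalReward (e :: l) = e.reward + totalReward l := by
  simp only [totalReward, List.map_cons, List.sum_cons]

theorem abs_totalReward_le (hr : ∀ h < M.H, ∀ s a, |M.r h s a| ≤ b) (π : Policy S A) {n h : ℕ}
    (hn : h + n ≤ M.H) (s : S) (a : A) {l : List (Step S A)}
    (hl : l ∈ (M.rollout π n h s a).support) : |totalReward l| ≤ n * b := by
  induction n generalizing h s a l with
  | zero =>
    simp only [rollout, PMF.support_pure, Set.mem_singleton_iff] at hl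
    simp [hl, totalReward]
  | succ n ih =>
    obtain ⟨s', l', hl', rfl⟩ := mem_support_rollout_succ hl
    rw [totalReward_cons]
    push_cast
    linarith [abs_add_le (M.r h s a) (totalReward l'), hr h (by omega) s a,
      ih (by omega) s' _ hl']

theorem abs_Q_le (hr : ∀ h < M.H, ∀ s a, |M.r h s a| ≤ b) (π : Policy S A) {h : ℕ}
    (hh : h ≤ M.H) (s : S) (a : A) : |M.Q π h s a| ≤ (M.H - h : ℕ) * b :=
  abs_expect_le fun _ hl => abs_totalReward_le hr π (by omega) s a hl

theorem hasExpect_V (hr : ∀ h < M.H, ∀ s a, |M.r h s a| ≤ b) (π : Policy S A) {h : ℕ}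
    (hh : h ≤ M.H) (p : PMF S) : HasExpect p (M.V π h) :=
  .of_abs_le fun s _ => abs_Q_le hr π hh s (π h s)

theorem Q_le_Qstar (hr : ∀ h < M.H, ∀ s a, |M.r h s a| ≤ b) (π : Policy S A) {h : ℕ}
    (hh : h ≤ M.H) (s : S) (a : A) : M.Q π h s a ≤ M.Qstar h s a := by
  refine le_ciSup (f := fun π => M.Q π h s a) ⟨(M.H - h : ℕ) * b, ?_⟩ π
  rintro _ ⟨π', rfl⟩
  exact (abs_le.1 (abs_Q_le hr π' hh s a)).2

theorem Q_eq_reward_add_expect_V (hr : ∀ h < M.H, ∀ s a, |M.r h s a| ≤ b) (π : Policy S A)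
    {h : ℕ} (hh : h < M.H) (s : S) (a : A) :
    M.Q π h s a = M.r h s a + expect (M.P h s a) (M.V π (h + 1)) := by
  have hsub : M.H - h = M.H - (h + 1) + 1 := by omega
  have hint : HasExpect (M.rollout π (M.H - (h + 1) + 1) h s a) totalReward :=
    .of_abs_le fun l hl => abs_totalReward_le hr π (by omega) s a hl
  have htail : ∀ s', ∀ l ∈ (M.rollout π (M.H - (h + 1)) (h + 1) s' (π (h + 1) s')).support,
      |totalReward l| ≤ (M.H - (h + 1) : ℕ) * b := fun s' l hl =>
    abs_totalReward_le hr π (by omega) _ _ hl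
  have hmap : ∀ s', expect ((M.rollout π (M.H - (h + 1)) (h + 1) s' (π (h + 1) s')).map
      fun l => ⟨s, a, M.r h s a, s'⟩ :: l) totalReward = M.r h s a + M.V π (h + 1) s' := by
    intro s'
    rw [expect_map (.of_abs_le (C := b + (M.H - (h + 1) : ℕ) * b) fun l hl => ?_)]
    · simp only [totalReward_cons]
      rw [expect_add (hasExpect_const _ _) (.of_abs_le (htail s')), expect_const, V, Q_eq_expect]
    · obtain ⟨l', hl', rfl⟩ := (PMF.mem_support_map_iff _ _ _).1 hl
      rw [totalReward_cons]
      exact (abs_add_le _ _).trans (add_le_add (hr h hh s a) (htail s' l' hl'))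
  rw [rollout] at hint
  rw [Q_eq_expect, hsub, rollout, expect_bind hint]
  simp only [hmap]
  rw [expect_add (hasExpect_const _ _) (hasExpect_V hr π hh _), expect_const]

theorem Q_eq_Qstar_of_greedy (hr : ∀ h < M.H, ∀ s a, |M.r h s a| ≤ b) {π : Policy S A}
    (hπ : ∀ h s a, M.Qstar h s a ≤ M.Qstar h s (π h s)) {h : ℕ} (hh : h ≤ M.H) (s : S) (a : A) :
    M.Q π h s a = M.Qstar h s a := by
  induction hh using Nat.decreasingInduction generalizing s a with
  | self => rw [M.Q_of_horizon_le π le_rfl, M.Qstar_of_horizon_le le_rfl]; rfl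
  | of_succ h hh ih =>
    have : Nonempty (Policy S A) := ⟨π⟩
    refine le_antisymm (Q_le_Qstar hr π hh.le s a) (ciSup_le fun π' => ?_)
    rw [Q_eq_reward_add_expect_V hr π' hh, Q_eq_reward_add_expect_V hr π hh]
    gcongr
    refine expect_mono (hasExpect_V hr π' hh _) (hasExpect_V hr π hh _) fun s' _ => ?_
    calc M.V π' (h + 1) s' ≤ M.Qstar (h + 1) s' (π' (h + 1) s') := Q_le_Qstar hr π' hh s' _
      _ ≤ M.Qstar (h + 1) s' (π (h + 1) s') := hπ (h + 1) s' _
      _ = M.V π (h + 1) s' := (ih s' _).symm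

theorem bellman_Qstar [Finite A] [Nonempty A] (hr : ∀ h < M.H, ∀ s a, |M.r h s a| ≤ b) {h : ℕ}
    (hh : h < M.H) : M.bellman h (M.Qstar (h + 1)) = M.Qstar h := by
  choose π hπ using fun (h : ℕ) (s : S) => Finite.exists_max (M.Qstar h s)
  have hopt : ∀ {h : ℕ}, h ≤ M.H → ∀ s a, M.Q π h s a = M.Qstar h s a :=
    fun hh => Q_eq_Qstar_of_greedy hr hπ hh
  funext s a
  rw [← hopt hh.le, Q_eq_reward_add_expect_V hr π hh, bellman_eq_expect]
  refine congrArg (M.r h s a + ·) (expect_congr fun s' _ => ?_)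
  rw [V, hopt hh, ciSup_eq_of_forall_le (hπ (h + 1) s')]

theorem Vstar_le_of_forall_Qstar_le [Nonempty A] (hr : ∀ h < M.H, ∀ s a, |M.r h s a| ≤ b) {h : ℕ}
    (hh : h ≤ M.H) {s : S} {c : ℝ} (hc : ∀ a, M.Qstar h s a ≤ c) : M.Vstar h s ≤ c :=
  ciSup_le fun π => (Q_le_Qstar hr π hh s (π h s)).trans (hc _)

end Values

end EpisodicMDP

end RL
namespace RL.EpisodicMDP

variable {S : Type u} {A : Type v} (M : EpisodicMDP S A)

/-- The Bellman residual `f_h - T_h f_{h+1}`. -/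
noncomputable def residual (f : QFun S A) (h : ℕ) (x : S × A) : ℝ :=
  f h x.1 x.2 - M.bellman h (f (h + 1)) x.1 x.2

/-- The value-function candidates to which the analysis applies: sequences with values in `[0, 1]`
that vanish from the horizon on and whose Bellman backups again have values in `[0, 1]`. Members of
a Bellman complete class have this property. -/
structure Admissible (f : QFun S A) : Prop where
  mem_Icc : ∀ h s a, f h s a ∈ Set.Icc (0 : ℝ) 1
  eq_zero : ∀ h, M.H ≤ h → f h = 0
  bellman_mem_Icc : ∀ h < M.H, ∀ s a, M.bellman h (f (h + 1)) s a ∈ Set.Icc (0 : ℝ) 1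

variable {M} {f : QFun S A} {h : ℕ}

namespace Admissible

theorem abs_residual_le (hf : M.Admissible f) (hh : h < M.H) (x : S × A) :
    |M.residual f h x| ≤ 1 :=
  abs_sub_le_of_nonneg_of_le (hf.mem_Icc h x.1 x.2).1 (hf.mem_Icc h x.1 x.2).2
    (hf.bellman_mem_Icc h hh x.1 x.2).1 (hf.bellman_mem_Icc h hh x.1 x.2).2

theorem hasExpect_residual (hf : M.Admissible f) (hh : h < M.H) (p : PMF (S × A)) :
    HasExpect p (M.residual f h) :=
  .of_abs_le fun x _ => hf.abs_residual_le hh x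

theorem residual_sq_mem_Icc (hf : M.Admissible f) (hh : h < M.H) (x : S × A) :
    M.residual f h x ^ 2 ∈ Set.Icc (0 : ℝ) 1 :=
  ⟨sq_nonneg _, sq_le_one_iff_abs_le_one _ |>.2 (hf.abs_residual_le hh x)⟩

theorem hasExpect_residual_sq (hf : M.Admissible f) (hh : h < M.H) (p : PMF (S × A)) :
    HasExpect p fun x => M.residual f h x ^ 2 :=
  .of_abs_le (C := 1) fun x _ => by
    rw [abs_sq]
    exact (hf.residual_sq_mem_Icc hh x).2

variable [Finite A] [Nonempty A]

theorem ciSup_mem_Icc (hf : M.Admissible f) (h : ℕ) (s : S) : ⨆ a, f h s a ∈ Set.Icc (0 : ℝ) 1 :=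
  ciSup_mem_of_finite fun a => hf.mem_Icc h s a

theorem expect_ciSup_mem_Icc (hf : M.Admissible f) (h : ℕ) (p : PMF S) :
    expect p (fun s => ⨆ a, f h s a) ∈ Set.Icc (0 : ℝ) 1 :=
  expect_mem_Icc fun s => hf.ciSup_mem_Icc h s

theorem abs_reward_le (hf : M.Admissible f) : ∀ h < M.H, ∀ s a, |M.r h s a| ≤ 1 := by
  intro h hh s a
  have hnext := hf.expect_ciSup_mem_Icc (h + 1) (M.P h s a)
  have hbellman := hf.bellman_mem_Icc h hh s a
  rw [bellman_eq_expect] at hbellman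
  rw [abs_le]
  constructor <;> linarith [hnext.1, hnext.2, hbellman.1, hbellman.2]

theorem ciSup_eq_of_greedy (hf : M.Admissible f) {π : Policy S A}
    (hπ : ∀ h < M.H, ∀ s a, f h s a ≤ f h s (π h s)) (h : ℕ) (s : S) :
    ⨆ a, f h s a = f h s (π h s) := by
  refine ciSup_eq_of_forall_le fun a => ?_
  rcases lt_or_ge h M.H with hh | hh
  · exact hπ h hh s a
  · simp [hf.eq_zero h hh]

theorem sub_Q_eq_residual_add (hf : M.Admissible f) {π : Policy S A}
    (hπ : ∀ h < M.H, ∀ s a, f h s a ≤ f h s (π h s)) {h : ℕ} (hh : h < M.H) (s : S) (a : A) :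
    f h s a - M.Q π h s a = M.residual f h (s, a) +
      expect (M.P h s a) fun s' => f (h + 1) s' (π (h + 1) s') - M.V π (h + 1) s' := by
  have hfE : HasExpect (M.P h s a) fun s' => f (h + 1) s' (π (h + 1) s') :=
    .of_abs_le (C := 1) fun s' _ => by
      obtain ⟨h0, h1⟩ := hf.mem_Icc (h + 1) s' (π (h + 1) s')
      rwa [abs_of_nonneg h0]
  rw [expect_sub hfE (hasExpect_V hf.abs_reward_le π hh _),
    Q_eq_reward_add_expect_V hf.abs_reward_le π hh, residual, bellman_eq_expect]
  simp only [hf.ciSup_eq_of_greedy hπ]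
  ring

theorem sub_Q_eq_sum (hf : M.Admissible f) {π : Policy S A}
    (hπ : ∀ h < M.H, ∀ s a, f h s a ≤ f h s (π h s)) {n h : ℕ} (hn : h + n = M.H) (s : S) (a : A) :
    f h s a - M.Q π h s a =
      ∑ k ∈ Finset.range n, expect (M.stepLaw π k h s a) (M.residual f (h + k)) := by
  induction n generalizing h s a with
  | zero =>
    simp [hf.eq_zero h (by omega), M.Q_of_horizon_le π (show M.H ≤ h by omega)]
  | succ n ih =>
    have hlt : ∀ k ∈ Finset.range n, h + 1 + k < M.H := fun k hk => by
      have := Finset.mem_range.1 hk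
      omega
    have htail : ∀ k ∈ Finset.range n,
        expect (M.stepLaw π (k + 1) h s a) (M.residual f (h + (k + 1))) =
          expect (M.P h s a) fun s' =>
            expect (M.stepLaw π k (h + 1) s' (π (h + 1) s')) (M.residual f (h + 1 + k)) :=
      fun k hk => by
        rw [show h + (k + 1) = h + 1 + k by ring]
        exact expect_bind (hf.hasExpect_residual (hlt k hk) _)
    rw [Finset.sum_range_succ', Finset.sum_congr rfl htail, ← expect_sum fun k hk =>
      .of_abs_le fun s' _ => abs_expect_le fun x _ => hf.abs_residual_le (hlt k hk) x,
      stepLaw, expect_pure, add_comm _ (M.residual f _ _), hf.sub_Q_eq_residual_add hπ (by omega)]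
    exact congrArg _ (expect_congr fun s' _ => ih (by omega) s' _)

theorem sub_V_eq_sum (hf : M.Admissible f) {π : Policy S A}
    (hπ : ∀ h < M.H, ∀ s a, f h s a ≤ f h s (π h s)) :
    f 0 M.init (π 0 M.init) - M.V π 0 M.init =
      ∑ h ∈ Finset.range M.H, expect (M.visitLaw π h) (M.residual f h) := by
  simpa only [zero_add, V, visitLaw] using hf.sub_Q_eq_sum hπ (zero_add M.H) M.init (π 0 M.init)

end Admissible

end RL.EpisodicMDP
namespace RL.EpisodicMDP

variable {S : Type u} {A : Type v} (M : EpisodicMDP S A)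

section Runs

variable {M} {greedy : QFun S A → Policy S A} {sel : List (List (Step S A)) → QFun S A}

theorem length_eq_of_mem_support_runLaw {t : ℕ} {D : List (List (Step S A))}
    (hD : D ∈ (M.runLaw greedy sel t).support) : D.length = t := by
  induction t generalizing D with
  | zero =>
    simp only [runLaw, PMF.support_pure, Set.mem_singleton_iff] at hD
    simp [hD]
  | succ t ih =>
    simp only [runLaw, PMF.mem_support_bind_iff, PMF.mem_support_map_iff] at hD
    obtain ⟨D, hD, e, -, rfl⟩ := hD
    simp [ih hD]

theorem take_mem_support_runLaw {t i : ℕ} (hi : i ≤ t) {D : List (List (Step S A))}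
    (hD : D ∈ (M.runLaw greedy sel t).support) : D.take i ∈ (M.runLaw greedy sel i).support := by
  induction hi using Nat.decreasingInduction generalizing D with
  | self => rwa [List.take_of_length_le (length_eq_of_mem_support_runLaw hD).le]
  | of_succ i _ ih =>
    have hsucc := ih hD
    simp only [runLaw, PMF.mem_support_bind_iff, PMF.mem_support_map_iff] at hsucc
    obtain ⟨D', hD', e, -, htake⟩ := hsucc
    have hprefix : D' = D.take i := by
      rw [← List.take_left' (l₂ := [e]) (length_eq_of_mem_support_runLaw hD'), htake,
        List.take_take, min_eq_left i.le_succ]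
    rwa [← hprefix]

theorem lexpect_runLaw_take_le {Z : List (List (Step S A)) → ℝ≥0∞}
    (hZ : ∀ D, lexpect (M.episode (greedy (sel D))) (fun e => Z (D ++ [e])) ≤ Z D) (T t : ℕ) :
    lexpect (M.runLaw greedy sel T) (fun D => Z (D.take t)) ≤ Z [] := by
  induction T with
  | zero => simp [runLaw, lexpect_pure]
  | succ T ih =>
    simp only [runLaw, lexpect_bind, lexpect_map]
    refine (lexpect_mono fun D hD => ?_).trans ih
    have hlen := length_eq_of_mem_support_runLaw hD
    rcases le_or_gt t T with ht | ht
    · simp only [List.take_append_of_le_length (ht.trans_eq hlen.symm), lexpect_const, le_refl]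
    · have htake : ∀ e, (D ++ [e]).take t = D ++ [e] := fun e =>
        List.take_of_length_le (by simpa [hlen] using ht)
      simp only [htake, List.take_of_length_le (hlen.trans_le ht.le), hZ]

theorem dataset_append (D D' : List (List (Step S A))) (h : ℕ) :
    dataset (D ++ D') h = dataset D h ++ dataset D' h :=
  List.filterMap_append

theorem dataset_singleton (l : List (Step S A)) (h : ℕ) : dataset [l] h = l[h]?.toList := by
  cases hl : l[h]? <;> simp [dataset, hl]

theorem reward_eq_of_mem_dataset {t h : ℕ} {D : List (List (Step S A))}
    (hD : D ∈ (M.runLaw greedy sel t).support) {e : Step S A} (he : e ∈ dataset D h) :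
    e.reward = M.r h e.state e.action := by
  induction t generalizing D with
  | zero =>
    simp only [runLaw, PMF.support_pure, Set.mem_singleton_iff] at hD
    simp [hD, dataset] at he
  | succ t ih =>
    simp only [runLaw, PMF.mem_support_bind_iff, PMF.mem_support_map_iff] at hD
    obtain ⟨D, hD, l, hl, rfl⟩ := hD
    rw [dataset_append, List.mem_append, dataset_singleton, Option.mem_toList] at he
    exact he.elim (ih hD) (reward_eq_of_mem_support_episode hl)

end Runs

section ExcessLoss

/-- The centred noise `(T_h f_{h+1})(s, a) - r - max_{a'} f_{h+1}(s', a')` of the regression target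
of a recorded step. -/
noncomputable def noise (f : QFun S A) (h : ℕ) (e : Step S A) : ℝ :=
  M.bellman h (f (h + 1)) e.state e.action - e.reward - ⨆ a', f (h + 1) e.next a'

/-- The excess squared loss of `f_h` over the Bayes regressor `T_h f_{h+1}`. -/
noncomputable def excessLoss (f : QFun S A) (h : ℕ) (D : List (Step S A)) : ℝ :=
  loss D (f h) (f (h + 1)) - loss D (M.bellman h (f (h + 1))) (f (h + 1))

theorem excessLoss_eq_sum (f : QFun S A) (h : ℕ) (D : List (Step S A)) :
    M.excessLoss f h D = (D.map fun e => M.residual f h (e.state, e.action) ^ 2 +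
      2 * (M.residual f h (e.state, e.action) * M.noise f h e)).sum := by
  rw [excessLoss, loss, loss, sub_eq_iff_eq_add, ← List.sum_map_add]
  refine congrArg List.sum (List.map_congr_left fun e _ => ?_)
  simp only [residual, noise]
  ring

theorem excessLoss_append (f : QFun S A) (h : ℕ) (D D' : List (Step S A)) :
    M.excessLoss f h (D ++ D') = M.excessLoss f h D + M.excessLoss f h D' := by
  simp only [excessLoss_eq_sum, List.map_append, List.sum_append]

variable {M} [Finite A] [Nonempty A] {f g : QFun S A} {h : ℕ} {ε : ℝ}

namespace Admissible

theorem abs_noise_le (hf : M.Admissible f) {e : Step S A}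
    (he : e.reward = M.r h e.state e.action) : |M.noise f h e| ≤ 1 := by
  obtain ⟨hE0, hE1⟩ := hf.expect_ciSup_mem_Icc (h + 1) (M.P h e.state e.action)
  obtain ⟨hv0, hv1⟩ := hf.ciSup_mem_Icc (h + 1) e.next
  rw [noise, he, bellman_eq_expect, add_sub_cancel_left]
  exact abs_sub_le_of_nonneg_of_le hE0 hE1 hv0 hv1

theorem lexpect_exp_neg_excessLoss_singleton_le (hf : M.Admissible f) (hh : h < M.H) (x : S × A) :
    lexpect (M.P h x.1 x.2) (fun s' => ENNReal.ofReal (Real.exp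
      (-(M.excessLoss f h [⟨x.1, x.2, M.r h x.1 x.2, s'⟩] / 8)))) ≤
      ENNReal.ofReal (Real.exp (-(M.residual f h x ^ 2 / 16))) := by
  set δ := M.residual f h x with hδ
  set v : S → ℝ := fun s' => ⨆ a', f (h + 1) s' a'
  have hnoise : ∀ s', M.noise f h ⟨x.1, x.2, M.r h x.1 x.2, s'⟩ =
      expect (M.P h x.1 x.2) v - v s' := fun s' => by
    rw [noise, bellman_eq_expect, add_sub_cancel_left]
  have hsplit : ∀ s', ENNReal.ofReal (Real.exp
      (-(M.excessLoss f h [⟨x.1, x.2, M.r h x.1 x.2, s'⟩] / 8))) =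
      ENNReal.ofReal (Real.exp (-(δ ^ 2 / 8))) *
        ENNReal.ofReal (Real.exp (δ / 4 * (v s' - expect (M.P h x.1 x.2) v))) := fun s' => by
    rw [← ENNReal.ofReal_mul (Real.exp_nonneg _), ← Real.exp_add, excessLoss_eq_sum,
      List.map_singleton, List.sum_singleton, hnoise, ← hδ]
    congr 2
    ring
  have hδ1 : |δ / 4| ≤ 1 := by
    rw [abs_div, abs_of_pos (four_pos : (0 : ℝ) < 4)]
    linarith [hf.abs_residual_le hh x]
  have hcentered : ∀ s', |v s' - expect (M.P h x.1 x.2) v| ≤ 1 := fun s' =>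
    abs_sub_le_of_nonneg_of_le (hf.ciSup_mem_Icc _ s').1 (hf.ciSup_mem_Icc _ s').2
      (hf.expect_ciSup_mem_Icc _ _).1 (hf.expect_ciSup_mem_Icc _ _).2
  simp only [hsplit, lexpect_const_mul]
  calc _ ≤ ENNReal.ofReal (Real.exp (-(δ ^ 2 / 8))) * ENNReal.ofReal (Real.exp ((δ / 4) ^ 2)) := by
        gcongr
        exact lexpect_exp_centered_le hcentered hδ1
    _ = _ := by
        rw [← ENNReal.ofReal_mul (Real.exp_nonneg _), ← Real.exp_add]
        congr 2
        ring

theorem lexpect_exp_neg_excessLoss_episode_le (hf : M.Admissible f) (hh : h < M.H)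
    (π : Policy S A) :
    lexpect (M.episode π) (fun l => ENNReal.ofReal (Real.exp
      (-(M.excessLoss f h (dataset [l] h) / 8)))) ≤
      ENNReal.ofReal (Real.exp
        (-(expect (M.visitLaw π h) (fun x => M.residual f h x ^ 2) / 32))) := by
  have hφ : ∀ x, M.residual f h x ^ 2 / 16 ∈ Set.Icc (0 : ℝ) 1 := fun x => by
    obtain ⟨h0, h1⟩ := hf.residual_sq_mem_Icc hh x
    constructor <;> linarith
  calc _ = lexpect ((M.episode π).map fun l => l[h]?) (fun o => ENNReal.ofReal (Real.exp
          (-(M.excessLoss f h o.toList / 8)))) := by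
        simp only [lexpect_map, dataset_singleton]
    _ = lexpect (M.visitLaw π h) fun x => lexpect (M.P h x.1 x.2) fun s' => ENNReal.ofReal
          (Real.exp (-(M.excessLoss f h [⟨x.1, x.2, M.r h x.1 x.2, s'⟩] / 8))) := by
        simp only [M.episode_map_getElem? π hh, lexpect_bind, lexpect_map, Option.toList_some]
    _ ≤ lexpect (M.visitLaw π h) fun x =>
          ENNReal.ofReal (Real.exp (-(M.residual f h x ^ 2 / 16))) :=
        lexpect_mono fun x _ => hf.lexpect_exp_neg_excessLoss_singleton_le hh x
    _ ≤ _ := lexpect_exp_neg_le hφ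
    _ = _ := by
        simp only [div_eq_inv_mul, expect_const_mul]
        congr 3
        ring

end Admissible

end ExcessLoss

section Deviation

/-- The expected squared Bellman residuals of `f` at step `h`, summed over the policies that were
executed to collect the episodes `D`. -/
noncomputable def cumulativeError (greedy : QFun S A → Policy S A)
    (sel : List (List (Step S A)) → QFun S A) (f : QFun S A) (h : ℕ)
    (D : List (List (Step S A))) : ℝ :=
  ∑ i ∈ Finset.range D.length,
    expect (M.visitLaw (greedy (sel (D.take i))) h) fun x => M.residual f h x ^ 2

/-- The amount by which the cumulative error of `f` at step `h` exceeds what the excess loss on the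
collected data accounts for. The weights are those for which its exponential is a
supermartingale. -/
noncomputable def deviation (greedy : QFun S A → Policy S A)
    (sel : List (List (Step S A)) → QFun S A) (f : QFun S A) (h : ℕ)
    (D : List (List (Step S A))) : ℝ :=
  M.cumulativeError greedy sel f h D / 32 - M.excessLoss f h (dataset D h) / 8

variable {M} {greedy : QFun S A → Policy S A}
  {sel : List (List (Step S A)) → QFun S A} {f g : QFun S A} {h : ℕ} {ε : ℝ}

theorem cumulativeError_append_singleton (D : List (List (Step S A))) (l : List (Step S A)) :
    M.cumulativeError greedy sel f h (D ++ [l]) = M.cumulativeError greedy sel f h D +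
      expect (M.visitLaw (greedy (sel D)) h) fun x => M.residual f h x ^ 2 := by
  rw [cumulativeError, List.length_append, List.length_singleton, Finset.sum_range_succ,
    List.take_left' rfl, cumulativeError]
  congr 1
  refine Finset.sum_congr rfl fun i hi => ?_
  rw [List.take_append_of_le_length (Finset.mem_range.1 hi).le]

theorem deviation_append_singleton (D : List (List (Step S A))) (l : List (Step S A)) :
    M.deviation greedy sel f h (D ++ [l]) = M.deviation greedy sel f h D +
      expect (M.visitLaw (greedy (sel D)) h) (fun x => M.residual f h x ^ 2) / 32 +
      -(M.excessLoss f h (dataset [l] h) / 8) := by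
  rw [deviation, cumulativeError_append_singleton, dataset_append, excessLoss_append, deviation]
  ring

namespace Admissible

variable [Finite A] [Nonempty A]

theorem lexpect_exp_deviation_le_one (hf : M.Admissible f) (hh : h < M.H) (T t : ℕ) :
    lexpect (M.runLaw greedy sel T) (fun D => ENNReal.ofReal (Real.exp
      (M.deviation greedy sel f h (D.take t)))) ≤ 1 := by
  refine (lexpect_runLaw_take_le
    (Z := fun D => ENNReal.ofReal (Real.exp (M.deviation greedy sel f h D)))
    (fun D => ?_) T t).trans_eq ?_
  · simp only [deviation_append_singleton, Real.exp_add _ (-_),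
      ENNReal.ofReal_mul (Real.exp_nonneg _), lexpect_const_mul]
    refine (mul_le_mul_right (hf.lexpect_exp_neg_excessLoss_episode_le hh _) _).trans_eq ?_
    rw [← ENNReal.ofReal_mul (Real.exp_nonneg _), ← Real.exp_add, add_neg_cancel_right]
  · simp [deviation, cumulativeError, excessLoss, dataset, loss]

section Lipschitz

theorem mul_sub_mul_le_two_mul {a b x y ε : ℝ} (ha : |a| ≤ 1) (hy : |y| ≤ 1) (hab : |a - b| ≤ ε)
    (hxy : |x - y| ≤ ε) : a * x - b * y ≤ 2 * ε := by
  have hax : a * (x - y) ≤ 1 * ε := (le_abs_self _).trans <| by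
    rw [abs_mul]
    exact mul_le_mul ha hxy (abs_nonneg _) zero_le_one
  have hby : (a - b) * y ≤ ε * 1 := (le_abs_self _).trans <| by
    rw [abs_mul]
    exact mul_le_mul hab hy (abs_nonneg _) ((abs_nonneg _).trans hab)
  linarith

variable (hf : M.Admissible f) (hg : M.Admissible g) (hfg : ∀ h s a, |f h s a - g h s a| ≤ ε)
include hf hg hfg

theorem abs_bellman_sub_bellman_le (s : S) (a : A) :
    |M.bellman h (f (h + 1)) s a - M.bellman h (g (h + 1)) s a| ≤ ε := by
  have hasExpect : ∀ {f : QFun S A}, M.Admissible f →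
      HasExpect (M.P h s a) fun s' => ⨆ a', f (h + 1) s' a' := fun hf =>
    .of_abs_le (C := 1) fun s' _ => by
      rw [abs_of_nonneg (hf.ciSup_mem_Icc _ s').1]
      exact (hf.ciSup_mem_Icc _ s').2
  rw [bellman_eq_expect, bellman_eq_expect, add_sub_add_left_eq_sub,
    ← expect_sub (hasExpect hf) (hasExpect hg)]
  exact abs_expect_le fun s' _ => abs_ciSup_sub_ciSup_le fun a' => hfg (h + 1) s' a'

theorem abs_residual_sub_residual_le (x : S × A) :
    |M.residual f h x - M.residual g h x| ≤ 2 * ε := by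
  rw [residual, residual, sub_sub_sub_comm, two_mul]
  exact (abs_sub _ _).trans
    (add_le_add (hfg h x.1 x.2) (hf.abs_bellman_sub_bellman_le hg hfg x.1 x.2))

theorem abs_noise_sub_noise_le (e : Step S A) : |M.noise f h e - M.noise g h e| ≤ 2 * ε := by
  rw [noise, noise, sub_sub_sub_comm, sub_sub_sub_cancel_right, two_mul]
  exact (abs_sub _ _).trans (add_le_add (hf.abs_bellman_sub_bellman_le hg hfg _ _)
    (abs_ciSup_sub_ciSup_le fun a' => hfg (h + 1) e.next a'))

theorem residual_sq_le_add (hh : h < M.H) (x : S × A) :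
    M.residual f h x ^ 2 ≤ M.residual g h x ^ 2 + 4 * ε := by
  have hx := hf.abs_residual_sub_residual_le hg hfg (h := h) x
  linarith [mul_sub_mul_le_two_mul (hf.abs_residual_le hh x) (hg.abs_residual_le hh x) hx hx,
    sq (M.residual f h x), sq (M.residual g h x)]

theorem cumulativeError_le_add (hh : h < M.H) (D : List (List (Step S A))) :
    M.cumulativeError greedy sel f h D ≤
      M.cumulativeError greedy sel g h D + D.length * (4 * ε) := by
  have hexpect : ∀ p : PMF (S × A), expect p (fun x => M.residual f h x ^ 2) ≤
      expect p (fun x => M.residual g h x ^ 2) + 4 * ε := fun p => by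
    rw [← expect_const p (4 * ε),
      ← expect_add (hg.hasExpect_residual_sq hh p) (hasExpect_const p _)]
    exact expect_mono (hf.hasExpect_residual_sq hh p)
      ((hg.hasExpect_residual_sq hh p).add (hasExpect_const p _))
      fun x _ => hf.residual_sq_le_add hg hfg hh x
  refine (Finset.sum_le_sum fun i _ => hexpect _).trans_eq ?_
  rw [Finset.sum_add_distrib, Finset.sum_const, Finset.card_range, nsmul_eq_mul, cumulativeError]

theorem excessLoss_le_add (hh : h < M.H) {D : List (Step S A)}
    (hD : ∀ e ∈ D, e.reward = M.r h e.state e.action) :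
    M.excessLoss f h D ≤ M.excessLoss g h D + D.length * (12 * ε) := by
  rw [excessLoss_eq_sum, excessLoss_eq_sum, ← nsmul_eq_mul, ← List.sum_replicate,
    ← List.map_const', ← List.sum_map_add]
  refine List.sum_le_sum fun e he => ?_
  have hcross := mul_sub_mul_le_two_mul (hf.abs_residual_le hh (e.state, e.action))
    (hg.abs_noise_le (hD e he)) (hf.abs_residual_sub_residual_le hg hfg _)
    (hf.abs_noise_sub_noise_le hg hfg e)
  linarith [hf.residual_sq_le_add hg hfg hh (e.state, e.action)]

theorem deviation_le_add (hh : h < M.H) {D : List (List (Step S A))}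
    (hD : ∀ e ∈ dataset D h, e.reward = M.r h e.state e.action) :
    M.deviation greedy sel f h D ≤ M.deviation greedy sel g h D + D.length * (13 / 8 * ε) := by
  have herror := hf.cumulativeError_le_add hg hfg (greedy := greedy) (sel := sel) hh D
  have hexcess := hg.excessLoss_le_add hf (fun h s a => abs_sub_comm (f h s a) _ ▸ hfg h s a) hh hD
  have hε : 0 ≤ ε := (abs_nonneg _).trans (hfg 0 M.init (Classical.arbitrary A))
  have hlen : ((dataset D h).length : ℝ) * (12 * ε) ≤ D.length * (12 * ε) := by
    gcongr
    exact List.length_filterMap_le _ _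
  rw [deviation, deviation]
  linarith

end Lipschitz

end Admissible

end Deviation

end RL.EpisodicMDP
namespace RL.EpisodicMDP

section RatioNorm

variable {X : Type*} {p : ℝ} {ρ : X → ℝ≥0∞} {μ : PMF X} {c : ℝ≥0∞}

theorem ratioNorm_le_rpow (hp : 0 ≤ p) (h : ∀ x, ρ x ≤ c * μ x) : ratioNorm p ρ μ ≤ c ^ p := by
  rw [ratioNorm, if_pos fun x hx => by simpa [hx] using h x]
  calc ∑' x, μ x * (ρ x / μ x) ^ p ≤ ∑' x, μ x * c ^ p := by
        gcongr with x
        exact ENNReal.div_le_of_le_mul (h x)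
    _ = c ^ p := by rw [ENNReal.tsum_mul_right, μ.tsum_coe, one_mul]

theorem le_rpow_mul_rpow_of_ratioNorm_le (hp : 0 < p) (hc : c ≠ ⊤) (h : ratioNorm p ρ μ ≤ c)
    (x : X) : ρ x ≤ c ^ (1 / p) * μ x ^ (1 - 1 / p) := by
  rw [ratioNorm] at h
  split_ifs at h with hac
  swap
  · exact absurd (top_le_iff.1 h) hc
  by_cases hx : μ x = 0
  · simp [hac x hx]
  have hx' : μ x ≠ ⊤ := μ.apply_ne_top x
  have hpow : (ρ x / μ x) ^ p ≤ c / μ x := by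
    rw [ENNReal.le_div_iff_mul_le (.inl hx) (.inl hx'), mul_comm]
    exact (ENNReal.le_tsum x).trans h
  calc ρ x = ρ x / μ x * μ x := (ENNReal.div_mul_cancel hx hx').symm
    _ ≤ (c / μ x) ^ (1 / p) * μ x := by
        gcongr
        rw [one_div]
        exact (ENNReal.le_rpow_inv_iff hp).2 hpow
    _ = c ^ (1 / p) * μ x ^ (1 - 1 / p) := by
        rw [ENNReal.div_rpow_of_nonneg _ _ (by positivity), ENNReal.rpow_sub _ _ hx hx',
          ENNReal.rpow_one, ENNReal.div_eq_inv_mul, ENNReal.div_eq_inv_mul, mul_comm _ (c ^ _),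
          mul_assoc]

theorem one_add_mul_le_rpow_add (hp : 1 ≤ p) (t : ℝ≥0∞) :
    1 + ENNReal.ofReal p * t ≤ t ^ p + ENNReal.ofReal p := by
  have hp0 : 0 ≤ p := zero_le_one.trans hp
  rcases eq_or_ne t ⊤ with rfl | ht
  · simp [ENNReal.top_rpow_of_pos (zero_lt_one.trans_le hp)]
  lift t to ℝ≥0 using ht
  have hbernoulli := one_add_mul_self_le_rpow_one_add
    (show -1 ≤ (t : ℝ) - 1 by linarith [t.coe_nonneg]) hp
  rw [add_sub_cancel] at hbernoulli
  rw [← ENNReal.ofReal_coe_nnreal, ENNReal.ofReal_rpow_of_nonneg t.coe_nonneg hp0,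
    ← ENNReal.ofReal_one, ← ENNReal.ofReal_mul hp0,
    ← ENNReal.ofReal_add zero_le_one (mul_nonneg hp0 t.coe_nonneg),
    ← ENNReal.ofReal_add (Real.rpow_nonneg t.coe_nonneg p) hp0]
  exact ENNReal.ofReal_le_ofReal (by linarith)

theorem one_le_ratioNorm (hp : 1 ≤ p) (ρ μ : PMF X) : 1 ≤ ratioNorm p ρ μ := by
  rw [ratioNorm]
  split_ifs with hac
  swap
  · exact le_top
  have hpoint : ∀ x, μ x + ENNReal.ofReal p * ρ x ≤
      μ x * (ρ x / μ x) ^ p + ENNReal.ofReal p * μ x := fun x => by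
    by_cases hx : μ x = 0
    · simp [hac x hx, hx]
    calc μ x + ENNReal.ofReal p * ρ x = μ x * (1 + ENNReal.ofReal p * (ρ x / μ x)) := by
          rw [mul_add, mul_one, mul_left_comm, ENNReal.mul_div_cancel hx (μ.apply_ne_top x)]
      _ ≤ μ x * ((ρ x / μ x) ^ p + ENNReal.ofReal p) := by
          gcongr μ x * ?_
          exact one_add_mul_le_rpow_add hp _
      _ = _ := by rw [mul_add, mul_comm (μ x) (ENNReal.ofReal p)]
  have hsum := ENNReal.tsum_le_tsum hpoint
  simpa only [ENNReal.tsum_add, ENNReal.tsum_mul_left, PMF.tsum_coe, mul_one,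
    ENNReal.add_le_add_iff_right ENNReal.ofReal_ne_top] using hsum

end RatioNorm

variable {S : Type u} {A : Type v} (M : EpisodicMDP S A) {Pol : Set (Policy S A)} {h : ℕ} {p : ℝ}

/-- The coverability coefficient `max_h ∑_{s, a} sup_{π ∈ Pol} ρ_h^π(s, a)`. -/
noncomputable def coverability (Pol : Set (Policy S A)) : ℝ≥0∞ :=
  ⨆ h < M.H, ∑' x, ⨆ π ∈ Pol, M.occupancy π h x

variable {M}

theorem tsum_iSup_occupancy_le_coverability (hh : h < M.H) :
    ∑' x, ⨆ π ∈ Pol, M.occupancy π h x ≤ M.coverability Pol :=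
  le_iSup₂ (f := fun h (_ : h < M.H) => ∑' x, ⨆ π ∈ Pol, M.occupancy π h x) h hh

theorem one_le_tsum_iSup_occupancy (hPol : Pol.Nonempty) (hh : h < M.H) :
    1 ≤ ∑' x, ⨆ π ∈ Pol, M.occupancy π h x := by
  obtain ⟨π, hπ⟩ := hPol
  calc (1 : ℝ≥0∞) = ∑' x, M.visitLaw π h x := (PMF.tsum_coe _).symm
    _ ≤ _ := ENNReal.tsum_le_tsum fun x => by
        rw [← M.occupancy_eq_visitLaw π hh]
        exact le_iSup₂ (f := fun π (_ : π ∈ Pol) => M.occupancy π h x) π hπ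

theorem ratioNorm_occupancy_le_coverage {π : Policy S A} (hπ : π ∈ Pol) (hh : h < M.H)
    (μ : ℕ → PMF (S × A)) : ratioNorm p (M.occupancy π h) (μ h) ≤ M.coverage Pol p μ :=
  le_iSup₂_of_le π hπ <|
    le_iSup₂ (f := fun h (_ : h < M.H) => ratioNorm p (M.occupancy π h) (μ h)) h hh

theorem one_le_Ccw (hH : 1 ≤ M.H) (hPol : Pol.Nonempty) (hp : 1 ≤ p) : 1 ≤ M.Ccw Pol p := by
  obtain ⟨π, hπ⟩ := hPol
  refine le_iInf fun μ => le_trans ?_ (ratioNorm_occupancy_le_coverage hπ hH μ)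
  rw [funext (M.occupancy_eq_visitLaw π hH)]
  exact one_le_ratioNorm hp _ _

theorem coverability_le_coverage_rpow_mul (hp : 0 < p) {μ : ℕ → PMF (S × A)}
    (hμ : M.coverage Pol p μ ≠ ⊤) {B : ℝ≥0∞}
    (hB : ∀ h < M.H, ∑' x, μ h x ^ (1 - 1 / p) ≤ B) :
    M.coverability Pol ≤ M.coverage Pol p μ ^ (1 / p) * B := by
  refine iSup₂_le fun h hh => ?_
  calc ∑' x, ⨆ π ∈ Pol, M.occupancy π h x
      ≤ ∑' x, M.coverage Pol p μ ^ (1 / p) * μ h x ^ (1 - 1 / p) :=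
        ENNReal.tsum_le_tsum fun x => iSup₂_le fun π hπ =>
          le_rpow_mul_rpow_of_ratioNorm_le hp hμ (ratioNorm_occupancy_le_coverage hπ hh μ) x
    _ ≤ _ := by
        rw [ENNReal.tsum_mul_left]
        gcongr
        exact hB h hh

section Uniform

variable (M) [Nonempty A]

/-- The law of the state-action pair reached after `k` transitions when action `a` is taken in
state `s` at step `h`, and all later actions are uniformly random. -/
noncomputable def uniformStepLaw [Fintype A] : ℕ → ℕ → S → A → PMF (S × A)
  | 0, _, s, a => PMF.pure (s, a)
  | k + 1, h, s, a => (M.P h s a).bind fun s' =>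
      (PMF.uniformOfFintype A).bind fun a' => uniformStepLaw k (h + 1) s' a'

theorem le_card_mul_uniformOfFintype_bind [Fintype A] {X : Type*} (q : A → PMF X) (a : A)
    (x : X) : q a x ≤ Fintype.card A * (PMF.uniformOfFintype A).bind q x := by
  simp only [PMF.bind_apply, PMF.uniformOfFintype_apply]
  rw [ENNReal.tsum_mul_left, ← mul_assoc, ENNReal.mul_inv_cancel (by simp) (by simp), one_mul]
  exact ENNReal.le_tsum a

theorem stepLaw_le_uniformStepLaw [Fintype A] (π : Policy S A) (k h : ℕ) (s : S) (a : A)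
    (x : S × A) : M.stepLaw π k h s a x ≤ Fintype.card A ^ k * M.uniformStepLaw k h s a x := by
  induction k generalizing h s a with
  | zero => simp [stepLaw, uniformStepLaw]
  | succ k ih =>
    rw [stepLaw, uniformStepLaw, PMF.bind_apply, PMF.bind_apply, ← ENNReal.tsum_mul_left]
    refine ENNReal.tsum_le_tsum fun s' => ?_
    rw [mul_left_comm, pow_succ, mul_assoc]
    gcongr M.P h s a s' * ?_
    refine (ih (h + 1) s' _).trans ?_
    gcongr
    exact le_card_mul_uniformOfFintype_bind (fun a' => M.uniformStepLaw k (h + 1) s' a') _ x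

theorem exists_occupancy_le_mul [Finite A] :
    ∃ (c : ℝ≥0∞) (μ : ℕ → PMF (S × A)), c ≠ ⊤ ∧
      ∀ π, ∀ h < M.H, ∀ x, M.occupancy π h x ≤ c * μ h x := by
  cases nonempty_fintype A
  refine ⟨Fintype.card A ^ M.H,
    fun h => (PMF.uniformOfFintype A).bind (M.uniformStepLaw h 0 M.init), by finiteness,
    fun π h hh x => ?_⟩
  calc M.occupancy π h x = M.visitLaw π h x := M.occupancy_eq_visitLaw π hh x
    _ ≤ Fintype.card A ^ h * M.uniformStepLaw h 0 M.init (π 0 M.init) x :=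
        M.stepLaw_le_uniformStepLaw π h 0 M.init _ x
    _ ≤ Fintype.card A ^ h * (Fintype.card A *
          (PMF.uniformOfFintype A).bind (M.uniformStepLaw h 0 M.init) x) := by
        gcongr
        exact le_card_mul_uniformOfFintype_bind _ _ x
    _ ≤ _ := by
        rw [← mul_assoc, ← pow_succ]
        gcongr
        · exact_mod_cast Fintype.card_pos
        · exact hh

theorem coverability_ne_top [Finite A] (Pol : Set (Policy S A)) : M.coverability Pol ≠ ⊤ := by
  obtain ⟨c, μ, hc, hle⟩ := M.exists_occupancy_le_mul
  refine ne_top_of_le_ne_top hc (iSup₂_le fun h hh => ?_)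
  calc ∑' x, ⨆ π ∈ Pol, M.occupancy π h x ≤ ∑' x, c * μ h x :=
        ENNReal.tsum_le_tsum fun x => iSup₂_le fun π _ => hle π h hh x
    _ = c := by rw [ENNReal.tsum_mul_left, PMF.tsum_coe, mul_one]

theorem Ccw_ne_top [Finite A] (Pol : Set (Policy S A)) (hp : 0 ≤ p) : M.Ccw Pol p ≠ ⊤ := by
  obtain ⟨c, μ, hc, hle⟩ := M.exists_occupancy_le_mul
  refine ne_top_of_le_ne_top (ENNReal.rpow_ne_top_of_nonneg hp hc) (iInf_le_of_le μ ?_)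
  exact iSup₂_le fun π _ => iSup₂_le fun h hh => ratioNorm_le_rpow hp (hle π h hh)

end Uniform

end RL.EpisodicMDP
namespace RL.EpisodicMDP

variable {S : Type u} {A : Type v} {M : EpisodicMDP S A}

section Classes

variable {𝓕 : Set (QFun S A)} {F : ℕ → Set (S → A → ℝ)} {f : QFun S A} {h : ℕ}

theorem one_le_coveringNumber (h𝓕 : 𝓕.Nonempty) (ε : ℝ) : 1 ≤ M.coveringNumber 𝓕 ε := by
  obtain ⟨f, hf⟩ := h𝓕
  refine le_iInf₂ fun C hC => ?_
  obtain ⟨g, hg, -⟩ := hC f hf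
  exact_mod_cast Finset.card_pos.2 ⟨g, hg⟩

theorem exists_cover_card_le {ε : ℝ} {N : ℕ} (hN : M.coveringNumber 𝓕 ε ≤ N) :
    ∃ C : Finset (QFun S A), C.card ≤ N ∧
      ∀ f ∈ 𝓕, ∃ g ∈ C, ∀ h < M.H, ∀ s a, |f h s a - g h s a| ≤ ε := by
  have hlt : M.coveringNumber 𝓕 ε < (N + 1 : ℕ) := hN.trans_lt (by exact_mod_cast N.lt_succ_self)
  simp only [coveringNumber, iInf_lt_iff] at hlt
  obtain ⟨C, hC, hcard⟩ := hlt
  exact ⟨C, Nat.lt_succ_iff.1 (by exact_mod_cast hcard), hC⟩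

-- Moving the centres into the class costs a factor two in the radius.
theorem exists_net_card_le (h𝓕 : 𝓕.Nonempty) {ε : ℝ} {N : ℕ} (hN : M.coveringNumber 𝓕 ε ≤ N) :
    ∃ C : Finset (QFun S A), C.card ≤ N ∧ ↑C ⊆ 𝓕 ∧
      ∀ f ∈ 𝓕, ∃ g ∈ C, ∀ h < M.H, ∀ s a, |f h s a - g h s a| ≤ 2 * ε := by
  classical
  obtain ⟨C, hcard, hC⟩ := exists_cover_card_le hN
  have hcentre : ∀ c : QFun S A, ∃ g ∈ 𝓕,
      ∀ f ∈ 𝓕, (∀ h < M.H, ∀ s a, |f h s a - c h s a| ≤ ε) →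
        ∀ h < M.H, ∀ s a, |g h s a - c h s a| ≤ ε := fun c => by
    by_cases hc : ∃ g ∈ 𝓕, ∀ h < M.H, ∀ s a, |g h s a - c h s a| ≤ ε
    · obtain ⟨g, hg, hgc⟩ := hc
      exact ⟨g, hg, fun _ _ _ => hgc⟩
    · obtain ⟨g, hg⟩ := h𝓕
      exact ⟨g, hg, fun f hf hfc => absurd ⟨f, hf, hfc⟩ hc⟩
  choose centre hmem hclose using hcentre
  refine ⟨C.image centre, Finset.card_image_le.trans hcard, fun g hg => ?_, fun f hf => ?_⟩
  · obtain ⟨c, -, rfl⟩ := Finset.mem_image.1 (Finset.mem_coe.1 hg)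
    exact hmem c
  · obtain ⟨c, hc, hfc⟩ := hC f hf
    refine ⟨centre c, Finset.mem_image_of_mem centre hc, fun h hh s a => ?_⟩
    calc |f h s a - centre c h s a|
        ≤ |f h s a - c h s a| + |c h s a - centre c h s a| := abs_sub_le _ _ _
      _ ≤ ε + ε := by
          rw [abs_sub_comm (c h s a)]
          exact add_le_add (hfc h hh s a) (hclose c f hf hfc h hh s a)
      _ = 2 * ε := (two_mul ε).symm

theorem update_mem_classOf (hf : f ∈ M.classOf F) (hh : h < M.H) {g : S → A → ℝ} (hg : g ∈ F h) :
    Function.update f h g ∈ M.classOf F := by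
  refine ⟨fun k hk => ?_, fun k hk => ?_⟩
  · rcases eq_or_ne k h with rfl | hkh
    · rwa [Function.update_self]
    · rw [Function.update_of_ne hkh]
      exact hf.1 k hk
  · rw [Function.update_of_ne (hh.trans_le hk).ne']
    exact hf.2 k hk

theorem BellmanComplete.bellman_mem (hB : M.BellmanComplete F) (hf : f ∈ M.classOf F)
    (hh : h < M.H) : M.bellman h (f (h + 1)) ∈ F h := by
  rcases Nat.lt_or_eq_of_le (Nat.succ_le_of_lt hh) with hlt | heq
  · exact hB.1 h hlt _ (hf.1 _ hlt)
  · rw [hf.2 _ heq.ge]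
    exact hB.2 h heq

theorem UnitRange.admissible (hU : M.UnitRange F) (hB : M.BellmanComplete F)
    (hf : f ∈ M.classOf F) : M.Admissible f where
  mem_Icc h s a := by
    rcases lt_or_ge h M.H with hh | hh
    · exact hU h hh _ (hf.1 h hh) s a
    · simp [hf.2 h hh]
  eq_zero := hf.2
  bellman_mem_Icc h hh := hU h hh _ (hB.bellman_mem hf hh)

theorem Realizable.Qstar_mem_classOf (hR : M.Realizable F) : M.Qstar ∈ M.classOf F :=
  ⟨hR, fun _ hh => M.Qstar_of_horizon_le hh⟩

end Classes

variable {F : ℕ → Set (S → A → ℝ)} {greedy : QFun S A → Policy S A}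
  {sel : List (List (Step S A)) → QFun S A} {T : ℕ}

section Concentration

variable (M) in
/-- The event that, before each of the first `T` episodes, the excess losses of all members of the
class account for their cumulative Bellman errors up to `c`. -/
def Concentrated (F : ℕ → Set (S → A → ℝ)) (greedy : QFun S A → Policy S A)
    (sel : List (List (Step S A)) → QFun S A) (T : ℕ) (c : ℝ) (D : List (List (Step S A))) :
    Prop :=
  ∀ t < T, ∀ f ∈ M.classOf F, ∀ h < M.H, M.deviation greedy sel f h (D.take t) ≤ c

variable [Finite A] [Nonempty A]

theorem toOuterMeasure_exists_lt_deviation_le {C : Finset (QFun S A)}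
    (hC : ∀ g ∈ C, M.Admissible g) (T : ℕ) (ℓ : ℝ) :
    (M.runLaw greedy sel T).toOuterMeasure
      {D | ∃ t < T, ∃ h < M.H, ∃ g ∈ C, ℓ < M.deviation greedy sel g h (D.take t)} ≤
      ENNReal.ofReal (C.card * T * M.H * Real.exp (-ℓ)) := by
  have hunion : {D : List (List (Step S A)) | ∃ t < T, ∃ h < M.H, ∃ g ∈ C,
        ℓ < M.deviation greedy sel g h (D.take t)} =
      ⋃ i ∈ Finset.range T ×ˢ Finset.range M.H ×ˢ C,
        {D : List (List (Step S A)) | ℓ < M.deviation greedy sel i.2.2 i.2.1 (D.take i.1)} := by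
    ext D
    simp only [Set.mem_ofPred_eq, Set.mem_iUnion, Finset.mem_product, Finset.mem_range, Prod.exists]
    grind
  calc _ ≤ ∑ i ∈ Finset.range T ×ˢ Finset.range M.H ×ˢ C, (M.runLaw greedy sel T).toOuterMeasure
          {D | ℓ < M.deviation greedy sel i.2.2 i.2.1 (D.take i.1)} := by
        rw [hunion]
        exact MeasureTheory.measure_biUnion_finset_le _ _
    _ ≤ (Finset.range T ×ˢ Finset.range M.H ×ˢ C).card • ENNReal.ofReal (Real.exp (-ℓ)) := by
        refine Finset.sum_le_card_nsmul _ _ _ fun i hi => ?_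
        simp only [Finset.mem_product, Finset.mem_range] at hi
        exact toOuterMeasure_lt_le_exp_neg _ _ _
          ((hC _ hi.2.2).lexpect_exp_deviation_le_one hi.2.1 T i.1)
    _ = _ := by
        rw [Finset.card_product, Finset.card_product, Finset.card_range, Finset.card_range,
          nsmul_eq_mul, ENNReal.ofReal_mul (by positivity), ← ENNReal.ofReal_natCast]
        push_cast
        congr 2
        ring

theorem concentrated_of_net {C : Finset (QFun S A)} (hU : M.UnitRange F)
    (hB : M.BellmanComplete F) (hCF : ↑C ⊆ M.classOf F)
    (hnet : ∀ f ∈ M.classOf F, ∃ g ∈ C, ∀ h < M.H, ∀ s a, |f h s a - g h s a| ≤ 2 * (1 / T))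
    {ℓ : ℝ} {D : List (List (Step S A))} (hD : D ∈ (M.runLaw greedy sel T).support)
    (hdev : ∀ t < T, ∀ h < M.H, ∀ g ∈ C, M.deviation greedy sel g h (D.take t) ≤ ℓ) :
    M.Concentrated F greedy sel T (ℓ + 13 / 4) D := fun t ht f hf h hh => by
  obtain ⟨g, hg, hfg⟩ := hnet f hf
  have hfg' : ∀ h s a, |f h s a - g h s a| ≤ 2 * (1 / (T : ℝ)) := fun h s a => by
    rcases lt_or_ge h M.H with hh | hh
    · exact hfg h hh s a
    · rw [hf.2 h hh, (hCF hg).2 h hh, sub_self, abs_zero]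
      positivity
  have hDt := take_mem_support_runLaw ht.le hD
  have hlen : (D.take t).length * (13 / 8 * (2 * (1 / (T : ℝ)))) ≤ 13 / 4 := by
    have htT : (t : ℝ) / T ≤ 1 := div_le_one_of_le₀ (by exact_mod_cast ht.le) T.cast_nonneg
    rw [length_eq_of_mem_support_runLaw hDt]
    linarith [show (t : ℝ) * (13 / 8 * (2 * (1 / T))) = 13 / 4 * (t / T) by ring]
  have happrox := (hU.admissible hB hf).deviation_le_add (hU.admissible hB (hCF hg)) hfg' hh
    (greedy := greedy) (sel := sel) fun e he => reward_eq_of_mem_dataset hDt he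
  linarith [hdev t ht h hh g hg]

theorem ofReal_one_sub_le_toOuterMeasure_concentrated (hU : M.UnitRange F)
    (hB : M.BellmanComplete F) (hF : (M.classOf F).Nonempty) {N : ℕ}
    (hN : M.coveringNumber (M.classOf F) (1 / (T : ℝ)) = N) (hT : 1 ≤ T) (hH : 1 ≤ M.H) {δ : ℝ}
    (hδ : 0 < δ) :
    ENNReal.ofReal (1 - δ) ≤ (M.runLaw greedy sel T).toOuterMeasure
      {D | M.Concentrated F greedy sel T (Real.log (N * T * M.H / δ) + 13 / 4) D} := by
  obtain ⟨C, hCN, hCF, hnet⟩ := exists_net_card_le hF hN.le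
  have hN1 : 1 ≤ N := by exact_mod_cast hN ▸ M.one_le_coveringNumber hF (1 / (T : ℝ))
  refine ofReal_one_sub_le_toOuterMeasure hδ.le
    ((toOuterMeasure_exists_lt_deviation_le (fun g hg => hU.admissible hB (hCF hg)) T
      (Real.log (N * T * M.H / δ))).trans (ENNReal.ofReal_le_ofReal ?_)) fun D hD => ?_
  · rw [Real.exp_neg, Real.exp_log (by positivity), ← div_eq_mul_inv,
      div_le_iff₀ (by positivity), mul_div_cancel₀ _ hδ.ne']
    gcongr
  · by_cases hbad : ∃ t < T, ∃ h < M.H, ∃ g ∈ C,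
        Real.log (N * T * M.H / δ) < M.deviation greedy sel g h (D.take t)
    · exact .inr hbad
    · push Not at hbad
      exact .inl (concentrated_of_net hU hB hCF hnet hD hbad)

end Concentration

section Optimism

variable {f : QFun S A} {h : ℕ} {β c : ℝ} {D : List (List (Step S A))}

theorem cumulativeError_le_of_mem_confidenceSet (hB : M.BellmanComplete F)
    (hf : f ∈ M.confidenceSet F β D) (hh : h < M.H) (hD : M.deviation greedy sel f h D ≤ c) :
    M.cumulativeError greedy sel f h D ≤ 4 * β + 32 * c := by
  have hloss := hf.2 h hh _ (hB.bellman_mem hf.1 hh)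
  rw [deviation, excessLoss] at hD
  linarith

variable (M) in
theorem cumulativeError_nonneg (greedy : QFun S A → Policy S A)
    (sel : List (List (Step S A)) → QFun S A) (f : QFun S A) (h : ℕ)
    (D : List (List (Step S A))) : 0 ≤ M.cumulativeError greedy sel f h D :=
  Finset.sum_nonneg fun _ _ => tsum_nonneg fun _ => mul_nonneg ENNReal.toReal_nonneg (sq_nonneg _)

-- Replacing the `h`-th component of `Q⋆` by `g` leaves the regression targets of step `h`
-- unchanged, and the Bayes regressor for them is `Q⋆_h` itself.
theorem Qstar_mem_confidenceSet [Finite A] [Nonempty A] (hR : M.Realizable F) {b : ℝ}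
    (hr : ∀ h < M.H, ∀ s a, |M.r h s a| ≤ b) (hc : 8 * c ≤ β)
    (hD : ∀ f ∈ M.classOf F, ∀ h < M.H, M.deviation greedy sel f h D ≤ c) :
    M.Qstar ∈ M.confidenceSet F β D := by
  refine ⟨hR.Qstar_mem_classOf, fun h hh g hg => ?_⟩
  have hdev := hD _ (update_mem_classOf hR.Qstar_mem_classOf hh hg) h hh
  rw [deviation, excessLoss, Function.update_self, Function.update_of_ne (Nat.succ_ne_self h),
    bellman_Qstar hr hh] at hdev
  linarith [M.cumulativeError_nonneg greedy sel (Function.update M.Qstar h g) h D]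

theorem Vstar_le_of_mem_confidenceSet [Nonempty A] (hR : M.Realizable F) {b : ℝ}
    (hr : ∀ h < M.H, ∀ s a, |M.r h s a| ≤ b) (hH : 1 ≤ M.H)
    (hgreedy : M.IsGreedyRule (M.classOf F) greedy) {v : ℝ}
    (hQ : M.Qstar ∈ M.confidenceSet F β D)
    (hv : ∀ f ∈ M.confidenceSet F β D, f 0 M.init (greedy f 0 M.init) ≤ v) :
    M.Vstar 0 M.init ≤ v :=
  Vstar_le_of_forall_Qstar_le hr M.H.zero_le fun a =>
    (hgreedy _ hR.Qstar_mem_classOf 0 hH M.init a).trans (hv _ hQ)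

end Optimism

section Regret

variable {Pol : Set (Policy S A)} {h : ℕ}

theorem cumulativeError_take {f : QFun S A} {D : List (List (Step S A))} {t : ℕ}
    (ht : t ≤ D.length) :
    M.cumulativeError greedy sel f h (D.take t) = ∑ i ∈ Finset.range t,
      expect (M.visitLaw (greedy (sel (D.take i))) h) fun x => M.residual f h x ^ 2 := by
  rw [cumulativeError, List.length_take_of_le ht]
  refine Finset.sum_congr rfl fun i hi => ?_
  rw [List.take_take, min_eq_left (Finset.mem_range.1 hi).le]

variable [Finite A] [Nonempty A]

theorem sum_expect_residual_le {π : ℕ → Policy S A} (hπ : ∀ t < T, π t ∈ Pol)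
    {f : ℕ → QFun S A} (hf : ∀ t < T, M.Admissible (f t)) (hT : 2 ≤ T) (hh : h < M.H) {R : ℝ}
    (hR : 0 < R) (hsq : ∀ t < T, ∑ i ∈ Finset.range t,
      expect (M.visitLaw (π i) h) (fun x => M.residual (f t) h x ^ 2) ≤ R) :
    ∑ t ∈ Finset.range T, expect (M.visitLaw (π t) h) (M.residual (f t) h) ≤
      2 * (M.coverability Pol).toReal +
        √(2 * (M.coverability Pol).toReal * R * T * Real.log T) := by
  set m : S × A → ℝ≥0∞ := fun x => ⨆ π ∈ Pol, M.occupancy π h x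
  have hle : ∑' x, m x ≤ M.coverability Pol := tsum_iSup_occupancy_le_coverability hh
  have hfin : ∑' x, m x ≠ ⊤ := ne_top_of_le_ne_top (M.coverability_ne_top Pol) hle
  have hsum : (∑' x, (m x).toReal) = (∑' x, m x).toReal :=
    (ENNReal.tsum_toReal_eq (ENNReal.ne_top_of_tsum_ne_top hfin)).symm
  have hone : 1 ≤ ∑' x, m x := one_le_tsum_iSup_occupancy ⟨π 0, hπ 0 (by omega)⟩ hh
  have hpos : 0 < ∑' x, (m x).toReal :=
    hsum ▸ ENNReal.toReal_pos (zero_lt_one.trans_le hone).ne' hfin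
  have hmC : ∑' x, (m x).toReal ≤ (M.coverability Pol).toReal :=
    hsum ▸ ENNReal.toReal_mono (M.coverability_ne_top Pol) hle
  have hdom : ∀ t < T, ∀ x, (M.visitLaw (π t) h x).toReal ≤ (m x).toReal := fun t ht x => by
    rw [← M.occupancy_eq_visitLaw _ hh]
    exact ENNReal.toReal_mono (ENNReal.ne_top_of_tsum_ne_top hfin x)
      (le_iSup₂ (f := fun π (_ : π ∈ Pol) => M.occupancy π h x) (π t) (hπ t ht))
  refine (sum_expect_le_of_sum_expect_sq_le hdom (fun _ => ENNReal.toReal_nonneg)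
    (ENNReal.summable_toReal hfin) hpos (fun t ht x => (hf t ht).abs_residual_le hh x) hT hR
    hsq).trans ?_
  gcongr

theorem sum_expect_residual_le_sqrt {π : ℕ → Policy S A} (hπ : ∀ t < T, π t ∈ Pol)
    {f : ℕ → QFun S A} (hf : ∀ t < T, M.Admissible (f t)) (hT : 2 ≤ T) (hh : h < M.H) {β : ℝ}
    (hβ : 2 ≤ β) (hsq : ∀ t < T, ∑ i ∈ Finset.range t,
      expect (M.visitLaw (π i) h) (fun x => M.residual (f t) h x ^ 2) ≤ 8 * β) :
    ∑ t ∈ Finset.range T, expect (M.visitLaw (π t) h) (M.residual (f t) h) ≤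
      6 * √((M.coverability Pol).toReal * (β * T * Real.log T)) := by
  set C := (M.coverability Pol).toReal
  have hT2 : (2 : ℝ) ≤ T := by exact_mod_cast hT
  have hlog : 1 ≤ β * Real.log T := by
    nlinarith [Real.log_two_gt_d9, Real.log_le_log zero_lt_two hT2]
  have hCT : C * T ≤ C * (β * T * Real.log T) := by
    rw [mul_right_comm β]
    exact mul_le_mul_of_nonneg_left (le_mul_of_one_le_left T.cast_nonneg hlog)
      ENNReal.toReal_nonneg
  rcases le_total C T with hC | hC
  · have hCsqrt : C ≤ √(C * (β * T * Real.log T)) := Real.le_sqrt_of_sq_le <| by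
      rw [sq]
      exact (mul_le_mul_of_nonneg_left hC ENNReal.toReal_nonneg).trans hCT
    have hsqrt : √(2 * C * (8 * β) * T * Real.log T) = 4 * √(C * (β * T * Real.log T)) := by
      rw [show 2 * C * (8 * β) * T * Real.log T = 4 ^ 2 * (C * (β * T * Real.log T)) by ring,
        Real.sqrt_mul (by positivity), Real.sqrt_sq zero_le_four]
    linarith [sum_expect_residual_le hπ hf hT hh (by linarith) hsq]
  · have hTsqrt : (T : ℝ) ≤ √(C * (β * T * Real.log T)) := Real.le_sqrt_of_sq_le <| by
      rw [sq]
      exact (mul_le_mul_of_nonneg_right hC T.cast_nonneg).trans hCT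
    have hunit : ∑ t ∈ Finset.range T, expect (M.visitLaw (π t) h) (M.residual (f t) h) ≤ T := by
      simpa using Finset.sum_le_card_nsmul (Finset.range T) _ (1 : ℝ) fun t ht =>
        (le_abs_self _).trans <| abs_expect_le fun x _ =>
          (hf t (Finset.mem_range.1 ht)).abs_residual_le hh x
    linarith [Real.sqrt_nonneg (C * (β * T * Real.log T))]

theorem regret_le_sum_expect_residual {D : List (List (Step S A))}
    (hf : ∀ t < T, M.Admissible (sel (D.take t)))
    (hgreedy : ∀ t < T, ∀ h < M.H, ∀ s a, sel (D.take t) h s a ≤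
      sel (D.take t) h s (greedy (sel (D.take t)) h s))
    (hopt : ∀ t < T, M.Vstar 0 M.init ≤
      sel (D.take t) 0 M.init (greedy (sel (D.take t)) 0 M.init)) :
    M.regret greedy sel T D ≤ ∑ h ∈ Finset.range M.H, ∑ t ∈ Finset.range T,
      expect (M.visitLaw (greedy (sel (D.take t))) h) (M.residual (sel (D.take t)) h) := by
  rw [Finset.sum_comm]
  refine Finset.sum_le_sum fun t ht => ?_
  rw [Finset.mem_range] at ht
  rw [← (hf t ht).sub_V_eq_sum (hgreedy t ht)]
  exact sub_le_sub_right (hopt t ht) _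

theorem regret_le_of_concentrated (hH : 1 ≤ M.H) (hU : M.UnitRange F) (hR : M.Realizable F)
    (hB : M.BellmanComplete F) (hgreedy : M.IsGreedyRule (M.classOf F) greedy)
    (hPol : ∀ f ∈ M.classOf F, greedy f ∈ Pol) (hT : 2 ≤ T) {β c : ℝ} (hβ : 2 ≤ β)
    (hc : 8 * c ≤ β) (hsel : M.IsGOLF F greedy β T sel) {D : List (List (Step S A))}
    (hD : D ∈ (M.runLaw greedy sel T).support) (hconc : M.Concentrated F greedy sel T c D) :
    M.regret greedy sel T D ≤
      6 * (M.H * √((M.coverability Pol).toReal * (β * T * Real.log T))) := by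
  have hr := (hU.admissible hB hR.Qstar_mem_classOf).abs_reward_le
  have hstep := fun t (ht : t < T) => hsel t ht _ (take_mem_support_runLaw ht.le hD)
  have hmem : ∀ t < T, sel (D.take t) ∈ M.classOf F := fun t ht => (hstep t ht).1.1
  have hadm : ∀ t < T, M.Admissible (sel (D.take t)) := fun t ht =>
    hU.admissible hB (hmem t ht)
  have hopt : ∀ t < T, M.Vstar 0 M.init ≤
      sel (D.take t) 0 M.init (greedy (sel (D.take t)) 0 M.init) := fun t ht =>
    Vstar_le_of_mem_confidenceSet hR hr hH hgreedy
      (Qstar_mem_confidenceSet hR hr hc (hconc t ht)) (hstep t ht).2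
  have herror : ∀ h < M.H, ∀ t < T, ∑ i ∈ Finset.range t, expect
      (M.visitLaw (greedy (sel (D.take i))) h) (fun x => M.residual (sel (D.take t)) h x ^ 2) ≤
        8 * β := fun h hh t ht => by
    rw [← cumulativeError_take (ht.le.trans_eq (length_eq_of_mem_support_runLaw hD).symm)]
    linarith [cumulativeError_le_of_mem_confidenceSet hB (hstep t ht).1 hh
      (hconc t ht _ (hmem t ht) h hh)]
  refine (regret_le_sum_expect_residual hadm (fun t ht => hgreedy _ (hmem t ht)) hopt).trans ?_
  refine (Finset.sum_le_card_nsmul (Finset.range M.H) _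
    (6 * √((M.coverability Pol).toReal * (β * T * Real.log T))) fun h hh =>
      sum_expect_residual_le_sqrt (fun t ht => hPol _ (hmem t ht)) hadm hT
        (Finset.mem_range.1 hh) hβ (herror h (Finset.mem_range.1 hh))).trans_eq ?_
  rw [Finset.card_range, nsmul_eq_mul, mul_left_comm]

theorem ofReal_one_sub_le_toOuterMeasure_regret_le (hH : 1 ≤ M.H) (hU : M.UnitRange F)
    (hR : M.Realizable F) (hB : M.BellmanComplete F)
    (hgreedy : M.IsGreedyRule (M.classOf F) greedy) (hPol : ∀ f ∈ M.classOf F, greedy f ∈ Pol)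
    (hT : 2 ≤ T) {δ : ℝ} (hδ : 0 < δ) (hδ1 : δ ≤ 1) {N : ℕ}
    (hN : M.coveringNumber (M.classOf F) (1 / (T : ℝ)) = N) {β : ℝ}
    (hβ : β = 50 * Real.log (N * T * M.H / δ)) (hsel : M.IsGOLF F greedy β T sel) :
    ENNReal.ofReal (1 - δ) ≤ (M.runLaw greedy sel T).toOuterMeasure {D |
      M.regret greedy sel T D ≤
        6 * (M.H * √((M.coverability Pol).toReal * (β * T * Real.log T)))} := by
  have hF : (M.classOf F).Nonempty := ⟨_, hR.Qstar_mem_classOf⟩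
  have hN1 : 1 ≤ N := by exact_mod_cast hN ▸ M.one_le_coveringNumber hF (1 / (T : ℝ))
  have hNTH : 2 ≤ N * T * M.H / δ := by
    rw [le_div_iff₀ hδ]
    have hNTH : 2 ≤ N * T * M.H := by
      simpa using Nat.mul_le_mul (Nat.mul_le_mul hN1 hT) hH
    have : (2 : ℝ) ≤ N * T * M.H := by exact_mod_cast hNTH
    linarith
  have hlog : 0.69 ≤ Real.log (N * T * M.H / δ) := by
    linarith [Real.log_two_gt_d9, Real.log_le_log zero_lt_two hNTH]
  refine (ofReal_one_sub_le_toOuterMeasure_concentrated (greedy := greedy) (sel := sel) hU hB hF hN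
    (by omega) hH hδ).trans (PMF.toOuterMeasure_mono _ fun D hD => ?_)
  exact regret_le_of_concentrated hH hU hR hB hgreedy hPol hT (by linarith) (by linarith) hsel
    hD.2 hD.1

end Regret

section Instance

variable [Finite A] [Nonempty A] {Pol : Set (Policy S A)} {p : ℝ}

variable (M) in
/-- The instance-dependent factor of the regret bound: the square root of the ratio between the
coverability coefficient and the `p`-th root of its `L^p` version. -/
noncomputable def coverabilityGap (Pol : Set (Policy S A)) (p : ℝ) : ℝ :=
  √((M.coverability Pol).toReal / (M.Ccw Pol p).toReal ^ (1 / p))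

theorem coverabilityGap_le_sqrt (hp : 1 ≤ p) {μ : ℕ → PMF (S × A)}
    (hμ : M.coverage Pol p μ = M.Ccw Pol p) {B : ℝ≥0}
    (hB : ∀ h < M.H, ∑' x, μ h x ^ (min (1 / 2) (1 - 1 / p) : ℝ) ≤ B) :
    M.coverabilityGap Pol p ≤ √(B : ℝ) := by
  have hCcw := M.Ccw_ne_top Pol (zero_le_one.trans hp)
  have hB' : ∀ h < M.H, ∑' x, μ h x ^ (1 - 1 / p) ≤ B := fun h hh =>
    (ENNReal.tsum_le_tsum fun x => ENNReal.rpow_le_rpow_of_exponent_ge ((μ h).coe_le_one x)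
      (min_le_right _ _)).trans (hB h hh)
  have hle := coverability_le_coverage_rpow_mul (zero_lt_one.trans_le hp) (hμ ▸ hCcw) hB'
  rw [hμ] at hle
  have hreal := ENNReal.toReal_mono (ENNReal.mul_ne_top
    (ENNReal.rpow_ne_top_of_nonneg (by positivity) hCcw) ENNReal.coe_ne_top) hle
  rw [ENNReal.toReal_mul, ← ENNReal.toReal_rpow, ENNReal.coe_toReal, mul_comm] at hreal
  exact Real.sqrt_le_sqrt (div_le_of_le_mul₀ (by positivity) B.coe_nonneg hreal)

theorem sqrt_coverability_mul_eq (hH : 1 ≤ M.H) (hPol : Pol.Nonempty) (hp : 1 ≤ p) (x : ℝ) :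
    √((M.coverability Pol).toReal * x) =
      M.coverabilityGap Pol p * √((M.Ccw Pol p).toReal ^ (1 / p) * x) := by
  have hpos : 0 < (M.Ccw Pol p).toReal ^ (1 / p) := Real.rpow_pos_of_pos (ENNReal.toReal_pos
    (zero_lt_one.trans_le (one_le_Ccw hH hPol hp)).ne' (M.Ccw_ne_top Pol (zero_le_one.trans hp))) _
  rw [coverabilityGap, ← Real.sqrt_mul (by positivity), ← mul_assoc, div_mul_cancel₀ _ hpos.ne']

end Instance

end RL.EpisodicMDP

theorem mainTheorem1_general :
    ∃ c K : ℝ, 0 < c ∧ 0 < K ∧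
      ∀ (S : Type u) (A : Type v) [Finite A] [Nonempty A]
        (M : RL.EpisodicMDP S A) (_ : 1 ≤ M.H) (Pol : Set (RL.Policy S A)) (p : ℝ) (_ : 1 ≤ p),
        ∃ L : ℝ,
          (∀ μ : ℕ → PMF (S × A), M.coverage Pol p μ = M.Ccw Pol p →
            ∀ B : ℝ≥0, (∀ h < M.H, ∑' x, (μ h x) ^ (min (1 / 2) (1 - 1 / p) : ℝ) ≤ B) →
              L ≤ K * √(B : ℝ)) ∧
          ∀ (F : ℕ → Set (S → A → ℝ)) (_ : M.UnitRange F)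
            (_ : M.Realizable F) (_ : M.BellmanComplete F)
            (greedy : RL.QFun S A → RL.Policy S A)
            (_ : M.IsGreedyRule (M.classOf F) greedy)
            (_ : ∀ f ∈ M.classOf F, greedy f ∈ Pol)
            (T : ℕ) (_ : 2 ≤ T) (δ : ℝ) (_ : 0 < δ) (_ : δ < 1)
            (N : ℕ) (_ : M.coveringNumber (M.classOf F) (1 / (T : ℝ)) = N)
            (β : ℝ) (_ : β = c * Real.log (N * T * M.H / δ))
            (sel : List (List (RL.Step S A)) → RL.QFun S A)
            (_ : M.IsGOLF F greedy β T sel),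
            ENNReal.ofReal (1 - δ) ≤
              (M.runLaw greedy sel T).toOuterMeasure
                {D | M.regret greedy sel T D ≤
                  L * (M.H * √((M.Ccw Pol p).toReal ^ (1 / p) * β * T * Real.log T))} := by
  refine ⟨50, 6, by norm_num, by norm_num, fun S A _ _ M hH Pol p hp =>
    ⟨6 * M.coverabilityGap Pol p, fun μ hμ B hB => ?_, ?_⟩⟩
  · gcongr
    exact RL.EpisodicMDP.coverabilityGap_le_sqrt hp hμ hB
  · intro F hU hR hB greedy hgreedy hPol T hT δ hδ hδ1 N hN β hβ sel hsel
    have hregret := RL.EpisodicMDP.ofReal_one_sub_le_toOuterMeasure_regret_le hH hU hR hB hgreedy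
      hPol hT hδ hδ1.le hN hβ hsel
    rw [RL.EpisodicMDP.sqrt_coverability_mul_eq hH ⟨_, hPol _ hR.Qstar_mem_classOf⟩ hp] at hregret
    convert hregret using 4
    ring_nf

theorem mainTheorem1 :
    ∃ c K : ℝ, 0 < c ∧ 0 < K ∧
      ∀ (S : Type u) (A : Type v) [Fintype A] [Nonempty A]
        (M : RL.EpisodicMDP S A) (_ : M.Normalized)
        (Pol : Set (RL.Policy S A)) (p : ℝ) (_ : 1 ≤ p)
        (μ : ℕ → PMF (S × A))
        (_ : M.coverage Pol p μ = M.Ccw Pol p)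
        (_ : ∀ h < M.H, ∑' x, (μ h x) ^ (1 / 2 : ℝ) ≠ ⊤),
        ∃ L : ℝ,
          (∀ B : ℝ≥0, (∀ h < M.H, ∑' x, (μ h x) ^ (min (1 / 2) (1 - 1 / p) : ℝ) ≤ B) →
            L ≤ K * √(B : ℝ)) ∧
          ∀ (F : ℕ → Set (S → A → ℝ)) (_ : M.UnitRange F)
            (_ : M.Realizable F) (_ : M.BellmanComplete F)
            (greedy : RL.QFun S A → RL.Policy S A)
            (_ : M.IsGreedyRule (M.classOf F) greedy)
            (_ : ∀ f ∈ M.classOf F, greedy f ∈ Pol)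
            (T : ℕ) (_ : 2 ≤ T) (δ : ℝ) (_ : 0 < δ) (_ : δ < 1)
            (N : ℕ) (_ : M.coveringNumber (M.classOf F) (1 / (T : ℝ)) = N)
            (β : ℝ) (_ : β = c * Real.log (N * T * M.H / δ))
            (sel : List (List (RL.Step S A)) → RL.QFun S A)
            (_ : M.IsGOLF F greedy β T sel),
            ENNReal.ofReal (1 - δ) ≤
              (M.runLaw greedy sel T).toOuterMeasure
                {D | M.regret greedy sel T D ≤
                  L * (M.H * √((M.Ccw Pol p).toReal ^ (1 / p) * β * T * Real.log T))} := by
  obtain ⟨c, K, hc, hK, hgolf⟩ := mainTheorem1_general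
  refine ⟨c, K, hc, hK, fun S A _ _ M hM Pol p hp μ hμ _ => ?_⟩
  exact (hgolf S A M hM.horizon_pos Pol p hp).imp fun _ hL => ⟨hL.1 μ hμ, hL.2⟩
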